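/- There is an absolute constant $C>0$ such that the following holds for all $n$, $k$, $f$, $v$, $\delta$. Let $f:\mathbb{R}^n\to\{0,1\}$ be the indicator function of an intersection of $k$ linear threshold functions, that is, of $k$ sets of the form $\{x: a\cdot x+b\ge 0\}$ or $\{x: a\cdot x+b>0\}$ with $a\in\mathbb{R}^n$, $b\in\mathbb{R}$. Let $v\in\mathbb{R}^n$ be a unit vector and let $0<\delta\le k/2$. Suppose that for every real polynomial $p$ in one variable of degree at most $2$ with $\mathbf{E}_{g\sim N(0,1)}[p(g)]=0$ and $\mathbf{E}_{g\sim N(0,1)}[p(g)^2]=1$ we have $$\bigl|\mathbf{E}_{G\sim N(0,I_n)}[f(G)\,p(v\cdot G)]\bigr|<\delta .$$ Let $G,G'\sim N(0,I_n)$ be standard Gaussian vectors on a common probability space that agree in the directions orthogonal to $v$ and are independent in the $v$-direction; that is, $G'-(v\cdot G')v=G-(v\cdot G)v$ almost surely, and $v\cdot G'$ is independent of $G$. Then $$\mathbf{E}\bigl[|f(G)-f(G')|\bigr]\le C\,\delta^{1/11}k^{4/11}\log^{2/11}(k/\delta).$$ -/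

import Mathlib

open MeasureTheory ProbabilityTheory
open scoped RealInnerProductSpace

/-- A linear threshold function on `ℝⁿ` is the sign of an affine function `⟪a, x⟫ + b`; this is the
set on which it is `1`. Both conventions for the sign at `0` are allowed. -/
def IsHalfspace {n : ℕ} (H : Set (EuclideanSpace ℝ (Fin n))) : Prop :=
  ∃ (a : EuclideanSpace ℝ (Fin n)) (b : ℝ), H = {x | 0 ≤ ⟪a, x⟫ + b} ∨ H = {x | 0 < ⟪a, x⟫ + b}

/-- `f` is the `{0, 1}`-valued indicator function of an intersection of `k` halfspaces of `ℝⁿ`. -/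
def IsHalfspaceIntersectionIndicator {n : ℕ} (k : ℕ) (f : EuclideanSpace ℝ (Fin n) → ℝ) : Prop :=
  ∃ H : Fin k → Set (EuclideanSpace ℝ (Fin n)),
    (∀ i, IsHalfspace (H i)) ∧ f = (⋂ i, H i).indicator (fun _ => 1)

/-- `G` and `G'` are standard Gaussian vectors in `ℝⁿ`, on a common probability space, that are the
same in the directions orthogonal to the unit vector `v` and independent in the direction `v`
(the `v`-component of `G'` is a fresh one, independent of the whole vector `G`). -/
structure IsResampledAlong {n : ℕ} {Ω : Type*} [MeasurableSpace Ω] (P : Measure Ω)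
    (v : EuclideanSpace ℝ (Fin n)) (G G' : Ω → EuclideanSpace ℝ (Fin n)) : Prop where
  law_left : HasLaw G (stdGaussian (EuclideanSpace ℝ (Fin n))) P
  law_right : HasLaw G' (stdGaussian (EuclideanSpace ℝ (Fin n))) P
  same_orthogonal : ∀ᵐ ω ∂P, G' ω - ⟪v, G' ω⟫ • v = G ω - ⟪v, G ω⟫ • v
  indep_direction : IndepFun (fun ω => ⟪v, G' ω⟫) G P

/-! Let `K` be the intersection and let `F t` be the Gaussian measure of its slice at height `t`
along `v`. Slices are treated as cylinders in the whole space, so that all of them are measured by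
the same Gaussian. The argument has three ingredients.

The measures of the slices are nearly constant. Log-concavity of the Gaussian measure makes `F`
quasiconcave. A monic quadratic with real roots `a`, `b` has Gaussian mean `1 + ab`, so the
mean-zero ones have roots `a` and `-1/a`. A continuity-type argument finds `a` such that `F` is at
least some `c` between these roots and at most `c` outside (`exists_polynomial_threshold`; linear
polynomials are the limit cases). For the normalised quadratic `p`, the product `(F - c) p` then has
constant sign, and the hypothesis bounds `E|F - c||p|` by `δ`. As `p` is small only near its roots,
`E|F - c|` is `O(√δ)` (`exists_integral_abs_sub_le`).

Nearly equal measures force nearly equal slices. The Gaussian Prékopa–Leindler inequality has a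
factor `exp(-‖x - y‖²/8)` at midpoints, so there is a strict gain when part of one slice is at
distance at least `ε` from another (`stdGaussian_midpoint_le`). Near equality makes that part small,
and what remains lies in the `ε`-neighbourhood of a slice, whose excess has measure at most `k * ε`
(`measureReal_thickening_iInter_diff_le`).

Finally, `f(G)` and `f(G')` are both compared with the indicator of one reference slice, which takes
the same value at `G` and `G'`. Optimising `ε` gives a bound of order `(δ k⁴)^(1/8)`, which implies
the stated one. -/

/-! ### Brunn–Minkowski and Prékopa–Leindler inequalities, from the line to Gaussian space. -/

/-- The one-dimensional Brunn–Minkowski inequality. -/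
lemma volume_add_volume_le_of_add_mem {X Y C : Set ℝ} (hX : MeasurableSet X)
    (hY : MeasurableSet Y) (hXne : X.Nonempty) (hYne : Y.Nonempty)
    (h : ∀ x ∈ X, ∀ y ∈ Y, x + y ∈ C) : volume X + volume Y ≤ volume C := by
  obtain ⟨x₀, hx₀⟩ := hXne
  obtain ⟨y₀, hy₀⟩ := hYne
  have key : ∀ K L : Set ℝ, IsCompact K → IsCompact L → K ⊆ X → L ⊆ Y →
      volume K + volume L ≤ volume C := by
    intro K L hK hL hKX hLY
    -- Adding a point keeps the compact sets nonempty, so a maximum `p` of the first and a minimum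
    -- `q` of the second exist. The translates `K + q` and `p + L` lie in `C` and meet at most at `p
    -- + q`.
    have hK' : IsCompact (insert x₀ K) := hK.insert x₀
    have hL' : IsCompact (insert y₀ L) := hL.insert y₀
    obtain ⟨p, hp, hpmax⟩ := hK'.exists_isMaxOn ⟨x₀, by simp⟩ continuousOn_id
    obtain ⟨q, hq, hqmin⟩ := hL'.exists_isMinOn ⟨y₀, by simp⟩ continuousOn_id
    have hpX : p ∈ X := by
      rcases hp with rfl | hp
      exacts [hx₀, hKX hp]
    have hqY : q ∈ Y := by
      rcases hq with rfl | hq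
      exacts [hy₀, hLY hq]
    have h1 : volume ((fun x => x + -q) ⁻¹' K) = volume K := measure_preimage_add_right _ _ _
    have h2 : volume ((fun x => x + -p) ⁻¹' L) = volume L := measure_preimage_add_right _ _ _
    rw [← h1, ← h2]
    have hdisj : AEDisjoint volume ((fun x => x + -q) ⁻¹' K) ((fun x => x + -p) ⁻¹' L) := by
      refine measure_mono_null (t := {p + q}) ?_ (by simp)
      rintro z ⟨hz1, hz2⟩
      have e1 : z + -q ≤ p := hpmax (Set.mem_insert_of_mem _ hz1)
      have e2 : q ≤ z + -p := hqmin (Set.mem_insert_of_mem _ hz2)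
      simp only [Set.mem_singleton_iff]
      linarith
    rw [← measure_union₀ ?_ hdisj]
    · refine measure_mono ?_
      rintro z (hz | hz)
      · simpa using h _ (hKX hz) q hqY
      · simpa using h p hpX _ (hLY hz)
    · exact ((hL.measurableSet).preimage (by fun_prop)).nullMeasurableSet
  rw [hX.measure_eq_iSup_isCompact, hY.measure_eq_iSup_isCompact]
  simp_rw [iSup_and']
  exact ENNReal.biSup_add_biSup_le' ⟨∅, by simp⟩ ⟨∅, by simp⟩ fun K hK L hL =>
    key K L hK.2 hL.2 hK.1 hL.1

/-- Layer-cake form of Brunn–Minkowski: at each level `t < 1` the superlevel sets of `f` and `g` are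
nonempty and their weighted sum lies in that of `h`; at levels `t ≥ 1` those of `f` and `g` are
empty. -/
lemma lintegral_add_le_of_superlevel {f g h : ℝ → ℝ} {l m : ℝ} (hl : 0 < l) (hm : 0 < m)
    (hf : Measurable f) (hg : Measurable g) (hh : Measurable h)
    (hf0 : ∀ x, 0 ≤ f x) (hg0 : ∀ x, 0 ≤ g x) (hh0 : ∀ x, 0 ≤ h x)
    (hf1 : ∀ x, f x ≤ 1) (hg1 : ∀ x, g x ≤ 1)
    (hfs : ∀ t < 1, ∃ x, t < f x) (hgs : ∀ t < 1, ∃ x, t < g x)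
    (hfgh : ∀ t, 0 < t → ∀ x y, t < f x → t < g y → t < h (l * x + m * y)) :
    ENNReal.ofReal l * (∫⁻ x, ENNReal.ofReal (f x)) + ENNReal.ofReal m * (∫⁻ x, ENNReal.ofReal (g x))
      ≤ ∫⁻ x, ENNReal.ofReal (h x) := by
  have scale : ∀ (c : ℝ), 0 < c → ∀ S : Set ℝ,
      ENNReal.ofReal c * volume S = volume ((c⁻¹ * ·) ⁻¹' S) := by
    intro c hc S
    rw [Real.volume_preimage_mul_left (inv_ne_zero hc.ne')]
    simp [abs_of_pos hc]
  rw [lintegral_eq_lintegral_meas_lt _ (Filter.Eventually.of_forall hf0) hf.aemeasurable,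
    lintegral_eq_lintegral_meas_lt _ (Filter.Eventually.of_forall hg0) hg.aemeasurable,
    lintegral_eq_lintegral_meas_lt _ (Filter.Eventually.of_forall hh0) hh.aemeasurable,
    ← lintegral_const_mul' _ _ ENNReal.ofReal_ne_top,
    ← lintegral_const_mul' _ _ ENNReal.ofReal_ne_top, ← lintegral_add_left]
  · refine setLIntegral_mono' measurableSet_Ioi fun t ht => ?_
    rcases lt_or_ge t 1 with h1 | h1
    · rw [scale l hl, scale m hm]
      obtain ⟨x₀, hx₀⟩ := hfs t h1
      obtain ⟨y₀, hy₀⟩ := hgs t h1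
      refine volume_add_volume_le_of_add_mem ?_ ?_ ⟨l * x₀, ?_⟩ ⟨m * y₀, ?_⟩ ?_
      · exact (measurableSet_lt measurable_const hf).preimage (by fun_prop)
      · exact (measurableSet_lt measurable_const hg).preimage (by fun_prop)
      · simpa [hl.ne'] using hx₀
      · simpa [hm.ne'] using hy₀
      · intro x hx y hy
        have := hfgh t ht _ _ hx hy
        simpa [mul_inv_cancel_left₀ hl.ne', mul_inv_cancel_left₀ hm.ne'] using this
    · have e1 : {a | t < f a} = ∅ := by
        ext a; simpa using (hf1 a).trans h1
      have e2 : {a | t < g a} = ∅ := by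
        ext a; simpa using (hg1 a).trans h1
      simp [e1, e2]
  · have : Antitone fun t => volume {a | t < f a} :=
      fun s t hst => measure_mono fun a ha => lt_of_le_of_lt hst ha
    exact this.measurable.const_mul _

/-- The one-dimensional Prékopa–Leindler inequality for bounded integrable functions. -/
theorem prekopa_leindler_real {f g h : ℝ → ℝ} {l m A B : ℝ} (hl : 0 < l) (hm : 0 < m)
    (hlm : l + m = 1) (hf : Measurable f) (hg : Measurable g) (hh : Measurable h)
    (hf0 : ∀ x, 0 ≤ f x) (hg0 : ∀ x, 0 ≤ g x) (hh0 : ∀ x, 0 ≤ h x)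
    (hfA : ∀ x, f x ≤ A) (hgB : ∀ x, g x ≤ B)
    (hfi : Integrable f) (hgi : Integrable g) (hhi : Integrable h)
    (hfgh : ∀ x y, f x ^ l * g y ^ m ≤ h (l * x + m * y)) :
    (∫ x, f x) ^ l * (∫ x, g x) ^ m ≤ ∫ x, h x := by
  have hI : 0 ≤ ∫ x, h x := integral_nonneg hh0
  have hbf : BddAbove (Set.range f) := ⟨A, by rintro _ ⟨x, rfl⟩; exact hfA x⟩
  have hbg : BddAbove (Set.range g) := ⟨B, by rintro _ ⟨x, rfl⟩; exact hgB x⟩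
  have hfa : ∀ x, f x ≤ ⨆ x, f x := le_ciSup hbf
  have hgb : ∀ x, g x ≤ ⨆ x, g x := le_ciSup hbg
  have hfs' : ∀ t < ⨆ x, f x, ∃ x, t < f x := fun t ht => exists_lt_of_lt_ciSup ht
  have hgs' : ∀ t < ⨆ x, g x, ∃ x, t < g x := fun t ht => exists_lt_of_lt_ciSup ht
  set a := ⨆ x, f x
  set b := ⨆ x, g x
  rcases (hf0 0).trans (hfa 0) |>.eq_or_lt with ha | ha
  · have : ∀ x, f x = 0 := fun x => le_antisymm ((hfa x).trans ha.ge) (hf0 x)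
    simpa [this, Real.zero_rpow hl.ne'] using hI
  rcases (hg0 0).trans (hgb 0) |>.eq_or_lt with hb | hb
  · have : ∀ x, g x = 0 := fun x => le_antisymm ((hgb x).trans hb.ge) (hg0 x)
    simpa [this, Real.zero_rpow hm.ne'] using hI
  have hc : 0 < a ^ l * b ^ m := by positivity
  -- Dividing by the suprema makes the superlevel sets of both functions nonempty on the same range
  -- of levels. The resulting additive inequality is stronger than the multiplicative one, which
  -- follows by weighted AM–GM.
  have main := lintegral_add_le_of_superlevel (f := fun x => f x / a) (g := fun x => g x / b)
    (h := fun x => h x / (a ^ l * b ^ m)) hl hm (hf.div_const _) (hg.div_const _)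
    (hh.div_const _) (fun x => div_nonneg (hf0 x) ha.le) (fun x => div_nonneg (hg0 x) hb.le)
    (fun x => div_nonneg (hh0 x) hc.le) (fun x => (div_le_one ha).2 (hfa x))
    (fun x => (div_le_one hb).2 (hgb x))
    (fun t ht => (hfs' (t * a) (by nlinarith)).imp fun x hx => (lt_div_iff₀ ha).2 hx)
    (fun t ht => (hgs' (t * b) (by nlinarith)).imp fun x hx => (lt_div_iff₀ hb).2 hx)
    (fun t ht x y hx hy => by
      rw [lt_div_iff₀ ha] at hx
      rw [lt_div_iff₀ hb] at hy
      rw [lt_div_iff₀ hc]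
      refine lt_of_lt_of_le ?_ (hfgh x y)
      have e : t * (a ^ l * b ^ m) = (t * a) ^ l * (t * b) ^ m := by
        rw [Real.mul_rpow ht.le ha.le, Real.mul_rpow ht.le hb.le]
        have : t = t ^ l * t ^ m := by rw [← Real.rpow_add ht, hlm, Real.rpow_one]
        nth_rw 1 [this]
        ring
      rw [e]
      exact mul_lt_mul'' (Real.rpow_lt_rpow (by positivity) hx hl)
        (Real.rpow_lt_rpow (by positivity) hy hm) (by positivity) (by positivity))
  rw [← ofReal_integral_eq_lintegral_ofReal (hfi.div_const _)
      (Filter.Eventually.of_forall fun x => div_nonneg (hf0 x) ha.le),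
    ← ofReal_integral_eq_lintegral_ofReal (hgi.div_const _)
      (Filter.Eventually.of_forall fun x => div_nonneg (hg0 x) hb.le),
    ← ofReal_integral_eq_lintegral_ofReal (hhi.div_const _)
      (Filter.Eventually.of_forall fun x => div_nonneg (hh0 x) hc.le),
    ← ENNReal.ofReal_mul hl.le, ← ENNReal.ofReal_mul hm.le, ← ENNReal.ofReal_add,
    ENNReal.ofReal_le_ofReal_iff, integral_div, integral_div, integral_div] at main
  · have hF : 0 ≤ ∫ x, f x := integral_nonneg hf0
    have hG : 0 ≤ ∫ x, g x := integral_nonneg hg0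
    have amgm := Real.geom_mean_le_arith_mean2_weighted hl.le hm.le
      (div_nonneg hF ha.le) (div_nonneg hG hb.le) hlm
    have := amgm.trans main
    rw [Real.div_rpow hF ha.le, Real.div_rpow hG hb.le, div_mul_div_comm,
      div_le_div_iff_of_pos_right hc] at this
    exact this
  · exact integral_nonneg fun x => div_nonneg (hh0 x) hc.le
  · exact mul_nonneg hl.le (integral_nonneg fun x => div_nonneg (hf0 x) ha.le)
  · exact mul_nonneg hm.le (integral_nonneg fun x => div_nonneg (hg0 x) hb.le)

/-- The Prékopa–Leindler inequality for the standard Gaussian measure on the line. -/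
theorem prekopa_leindler_gaussianReal {f g h : ℝ → ℝ} {l m A B D : ℝ} (hl : 0 < l) (hm : 0 < m)
    (hlm : l + m = 1) (hf : Measurable f) (hg : Measurable g) (hh : Measurable h)
    (hf0 : ∀ x, 0 ≤ f x) (hg0 : ∀ x, 0 ≤ g x) (hh0 : ∀ x, 0 ≤ h x)
    (hfA : ∀ x, f x ≤ A) (hgB : ∀ x, g x ≤ B) (hhD : ∀ x, h x ≤ D)
    (hfgh : ∀ x y, f x ^ l * g y ^ m * Real.exp (-(l * m / 2 * (x - y) ^ 2))
      ≤ h (l * x + m * y)) :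
    (∫ x, f x ∂(gaussianReal 0 1)) ^ l * (∫ x, g x ∂(gaussianReal 0 1)) ^ m
      ≤ ∫ x, h x ∂(gaussianReal 0 1) := by
  set φ := gaussianPDFReal 0 1 with hφ
  have hφm : Measurable φ := measurable_gaussianPDFReal 0 1
  have hφ0 : ∀ x, 0 ≤ φ x := gaussianPDFReal_nonneg 0 1
  have hφ' : ∀ x, φ x = (√(2 * Real.pi))⁻¹ * Real.exp (-(x ^ 2 / 2)) := by
    intro x; simp [hφ, gaussianPDFReal, neg_div]
  have hs : 0 < (√(2 * Real.pi))⁻¹ := by positivity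
  have hφb : ∀ x, φ x ≤ (√(2 * Real.pi))⁻¹ := by
    intro x
    rw [hφ']
    exact mul_le_of_le_one_right hs.le (Real.exp_le_one_iff.2 (by nlinarith [sq_nonneg x]))
  have hint : ∀ (F : ℝ → ℝ) (M : ℝ), Measurable F → (∀ x, 0 ≤ F x) → (∀ x, F x ≤ M) →
      Integrable fun x => φ x * F x := by
    intro F M hF h0 hM
    refine (integrable_gaussianPDFReal 0 1).mul_bdd (c := M) hF.aestronglyMeasurable ?_
    filter_upwards with x
    rw [Real.norm_of_nonneg (h0 x)]
    exact hM x
  have hconv : ∀ F : ℝ → ℝ, ∫ x, F x ∂(gaussianReal 0 1) = ∫ x, φ x * F x := by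
    intro F
    rw [integral_gaussianReal_eq_integral_smul one_ne_zero]
    simp [hφ]
  rw [hconv, hconv, hconv]
  refine prekopa_leindler_real (A := (√(2 * Real.pi))⁻¹ * A) (B := (√(2 * Real.pi))⁻¹ * B) hl hm hlm
    (hφm.mul hf) (hφm.mul hg) (hφm.mul hh) (fun x => mul_nonneg (hφ0 x) (hf0 x))
    (fun x => mul_nonneg (hφ0 x) (hg0 x)) (fun x => mul_nonneg (hφ0 x) (hh0 x))
    (fun x => mul_le_mul (hφb x) (hfA x) (hf0 x) hs.le)
    (fun x => mul_le_mul (hφb x) (hgB x) (hg0 x) hs.le)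
    (hint f A hf hf0 hfA) (hint g B hg hg0 hgB) (hint h D hh hh0 hhD) fun x y => ?_
  -- This is the identity `l x² + m y² = (l x + m y)² + l m (x - y)²` for `l + m = 1`; it produces
  -- the extra Gaussian factor.
  have e : φ x ^ l * φ y ^ m = φ (l * x + m * y) * Real.exp (-(l * m / 2 * (x - y) ^ 2)) := by
    rw [hφ', hφ', hφ', Real.mul_rpow hs.le (Real.exp_pos _).le,
      Real.mul_rpow hs.le (Real.exp_pos _).le, ← Real.exp_mul, ← Real.exp_mul]
    have hs1 : (√(2 * Real.pi))⁻¹ ^ l * (√(2 * Real.pi))⁻¹ ^ m = (√(2 * Real.pi))⁻¹ := by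
      rw [← Real.rpow_add hs, hlm, Real.rpow_one]
    rw [mul_mul_mul_comm, hs1, mul_assoc, ← Real.exp_add, ← Real.exp_add]
    congr 2
    have hm' : m = 1 - l := by linarith
    subst hm'
    ring
  rw [Real.mul_rpow (hφ0 x) (hf0 x), Real.mul_rpow (hφ0 y) (hg0 y), mul_mul_mul_comm, e, mul_assoc]
  refine mul_le_mul_of_nonneg_left ?_ (hφ0 _)
  rw [mul_comm]
  exact hfgh x y

lemma integrable_of_nonneg_of_le {α : Type*} [MeasurableSpace α] {μ : Measure α}
    [IsFiniteMeasure μ] {f : α → ℝ} {M : ℝ} (hf : Measurable f) (h0 : ∀ x, 0 ≤ f x)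
    (hM : ∀ x, f x ≤ M) : Integrable f μ :=
  Integrable.of_bound hf.aestronglyMeasurable M
    (Filter.Eventually.of_forall fun x => by rw [Real.norm_of_nonneg (h0 x)]; exact hM x)

/-- The Prékopa–Leindler inequality for the product of standard Gaussian measures. -/
theorem prekopa_leindler_pi_gaussianReal {l m : ℝ} (hl : 0 < l) (hm : 0 < m) (hlm : l + m = 1)
    (n : ℕ) : ∀ {f g h : (Fin n → ℝ) → ℝ} {A B D : ℝ},
    Measurable f → Measurable g → Measurable h →
    (∀ x, 0 ≤ f x) → (∀ x, 0 ≤ g x) → (∀ x, 0 ≤ h x) →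
    (∀ x, f x ≤ A) → (∀ x, g x ≤ B) → (∀ x, h x ≤ D) →
    (∀ x y, f x ^ l * g y ^ m * Real.exp (-(l * m / 2 * ∑ i, (x i - y i) ^ 2))
      ≤ h (l • x + m • y)) →
    (∫ x, f x ∂(Measure.pi fun _ : Fin n => gaussianReal 0 1)) ^ l *
      (∫ x, g x ∂(Measure.pi fun _ : Fin n => gaussianReal 0 1)) ^ m
      ≤ ∫ x, h x ∂(Measure.pi fun _ : Fin n => gaussianReal 0 1) := by
  induction n with
  | zero =>
    intro f g h A B D hf hg hh hf0 hg0 hh0 hfA hgB hhD H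
    have := H default default
    have e : ∀ F : (Fin 0 → ℝ) → ℝ,
        ∫ x, F x ∂(Measure.pi fun _ : Fin 0 => gaussianReal 0 1) = F default := by
      intro F
      rw [Measure.pi_of_empty _ default, integral_dirac]
    rw [e, e, e]
    rw [Subsingleton.elim (l • default + m • default : Fin 0 → ℝ) default] at this
    simpa using this
  | succ n ih =>
    intro f g h A B D hf hg hh hf0 hg0 hh0 hfA hgB hhD H
    set μ := Measure.pi fun _ : Fin n => gaussianReal 0 1
    let e := MeasurableEquiv.piFinSuccAbove (fun _ : Fin (n + 1) => ℝ) 0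
    have hm1 : ∀ t, Measurable fun z : Fin n → ℝ => e.symm (t, z) := fun t =>
      e.symm.measurable.comp (by fun_prop)
    have conv : ∀ {F : (Fin (n + 1) → ℝ) → ℝ} {M : ℝ}, Measurable F → (∀ x, 0 ≤ F x) →
        (∀ x, F x ≤ M) →
        ∫ x, F x ∂(Measure.pi fun _ : Fin (n + 1) => gaussianReal 0 1) =
          ∫ t, ∫ z, F (e.symm (t, z)) ∂μ ∂(gaussianReal 0 1) := by
      intro F M hF h0 hM
      have mp := (measurePreserving_piFinSuccAbove
        (fun _ : Fin (n + 1) => gaussianReal 0 1) 0).symm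
      rw [← mp.integral_comp' F, integral_prod]
      · exact integrable_of_nonneg_of_le (hF.comp e.symm.measurable) (fun _ => h0 _)
          (fun _ => hM _)
    have meas : ∀ {F : (Fin (n + 1) → ℝ) → ℝ}, Measurable F →
        Measurable fun t => ∫ z, F (e.symm (t, z)) ∂μ := by
      intro F hF
      have : StronglyMeasurable fun p : ℝ × (Fin n → ℝ) => F (e.symm p) :=
        (hF.comp e.symm.measurable).stronglyMeasurable
      exact (this.integral_prod_right' (ν := μ)).measurable
    have bound : ∀ {F : (Fin (n + 1) → ℝ) → ℝ} {M : ℝ}, Measurable F → (∀ x, 0 ≤ F x) →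
        (∀ x, F x ≤ M) → ∀ t, ∫ z, F (e.symm (t, z)) ∂μ ≤ M := by
      intro F M hF h0 hM t
      calc ∫ z, F (e.symm (t, z)) ∂μ ≤ ∫ z, M ∂μ :=
            integral_mono (integrable_of_nonneg_of_le (hF.comp (hm1 t)) (fun _ => h0 _)
              (fun _ => hM _)) (integrable_const _) fun z => hM _
        _ = M := by simp
    rw [conv hf hf0 hfA, conv hg hg0 hgB, conv hh hh0 hhD]
    refine prekopa_leindler_gaussianReal hl hm hlm (meas hf) (meas hg) (meas hh)
      (fun t => integral_nonneg fun _ => hf0 _) (fun t => integral_nonneg fun _ => hg0 _)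
      (fun t => integral_nonneg fun _ => hh0 _) (bound hf hf0 hfA) (bound hg hg0 hgB)
      (bound hh hh0 hhD) fun s t => ?_
    set c := Real.exp (-(l * m / 2 * (s - t) ^ 2)) with hc
    have hc0 : 0 < c := Real.exp_pos _
    -- The induction hypothesis is applied on the fibres, with the first coordinate's factor `c`
    -- moved into `h`. Multiplied back, it is exactly the factor required by the one-dimensional
    -- inequality for the fibre integrals.
    have key := ih (f := fun z => f (e.symm (s, z))) (g := fun z => g (e.symm (t, z)))
      (h := fun z => h (e.symm (l * s + m * t, z)) / c) (hf.comp (hm1 s)) (hg.comp (hm1 t))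
      ((hh.comp (hm1 _)).div_const _) (fun _ => hf0 _) (fun _ => hg0 _)
      (fun _ => div_nonneg (hh0 _) hc0.le) (fun _ => hfA _) (fun _ => hgB _)
      (fun _ => div_le_div_of_nonneg_right (hhD _) hc0.le) (fun x y => by
        rw [le_div_iff₀ hc0, mul_assoc, hc, ← Real.exp_add]
        have := H (e.symm (s, x)) (e.symm (t, y))
        have e1 : l • e.symm (s, x) + m • e.symm (t, y) =
            e.symm (l * s + m * t, l • x + m • y) := by
          ext i
          refine Fin.cases ?_ (fun j => ?_) i <;> simp [e, Fin.insertNthEquiv]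
        have e2 : ∀ (r : ℝ) (z : Fin n → ℝ), e.symm (r, z) 0 = r := fun r z => by simp [e]
        have e3 : ∀ (r : ℝ) (z : Fin n → ℝ) i, e.symm (r, z) (Fin.succ i) = z i :=
          fun r z i => by simp [e]
        simp only [e1, Fin.sum_univ_succ, e2, e3] at this
        refine le_of_eq_of_le ?_ this
        congr 2
        ring)
    rw [integral_div, le_div_iff₀ hc0] at key
    exact key

variable {n : ℕ}

/-- The Prékopa–Leindler inequality for the standard Gaussian measure on Euclidean space. -/
theorem prekopa_leindler_stdGaussian {f g h : EuclideanSpace ℝ (Fin n) → ℝ} {l m A B D : ℝ}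
    (hl : 0 < l) (hm : 0 < m)
    (hlm : l + m = 1) (hf : Measurable f) (hg : Measurable g) (hh : Measurable h)
    (hf0 : ∀ x, 0 ≤ f x) (hg0 : ∀ x, 0 ≤ g x) (hh0 : ∀ x, 0 ≤ h x)
    (hfA : ∀ x, f x ≤ A) (hgB : ∀ x, g x ≤ B) (hhD : ∀ x, h x ≤ D)
    (hfgh : ∀ x y, f x ^ l * g y ^ m * Real.exp (-(l * m / 2 * ‖x - y‖ ^ 2))
      ≤ h (l • x + m • y)) :
    (∫ x, f x ∂(stdGaussian (EuclideanSpace ℝ (Fin n)))) ^ l *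
      (∫ x, g x ∂(stdGaussian (EuclideanSpace ℝ (Fin n)))) ^ m
      ≤ ∫ x, h x ∂(stdGaussian (EuclideanSpace ℝ (Fin n))) := by
  have hL : Measurable (WithLp.toLp 2 : (Fin n → ℝ) → EuclideanSpace ℝ (Fin n)) := by fun_prop
  rw [← map_pi_eq_stdGaussian, integral_map hL.aemeasurable hf.aestronglyMeasurable,
    integral_map hL.aemeasurable hg.aestronglyMeasurable,
    integral_map hL.aemeasurable hh.aestronglyMeasurable]
  refine prekopa_leindler_pi_gaussianReal hl hm hlm n (hf.comp hL) (hg.comp hL) (hh.comp hL)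
    (fun _ => hf0 _) (fun _ => hg0 _) (fun _ => hh0 _) (fun _ => hfA _) (fun _ => hgB _)
    (fun _ => hhD _) fun x y => ?_
  have := hfgh (WithLp.toLp 2 x) (WithLp.toLp 2 y)
  rw [EuclideanSpace.real_norm_sq_eq] at this
  simpa using this

/-! ### Log-concavity of the Gaussian measure, with a gain for distant sets. -/

/-- The standard Gaussian measure is log-concave. -/
theorem stdGaussian_real_rpow_mul_le {A B C : Set (EuclideanSpace ℝ (Fin n))} {l m : ℝ}
    (hl : 0 < l) (hm : 0 < m) (hlm : l + m = 1) (hA : MeasurableSet A) (hB : MeasurableSet B)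
    (hC : MeasurableSet C) (h : ∀ x ∈ A, ∀ y ∈ B, l • x + m • y ∈ C) :
    (stdGaussian (EuclideanSpace ℝ (Fin n))).real A ^ l *
      (stdGaussian (EuclideanSpace ℝ (Fin n))).real B ^ m ≤
      (stdGaussian (EuclideanSpace ℝ (Fin n))).real C := by
  have i0 : ∀ (S : Set (EuclideanSpace ℝ (Fin n))) x, (0 : ℝ) ≤ S.indicator 1 x :=
    fun S x => Set.indicator_nonneg (fun _ _ => zero_le_one) x
  have i1 : ∀ (S : Set (EuclideanSpace ℝ (Fin n))) x, S.indicator (1 : EuclideanSpace ℝ (Fin n) → ℝ) x ≤ 1 :=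
    fun S x => Set.indicator_le_self' (fun _ _ => zero_le_one) x
  rw [← integral_indicator_one hA, ← integral_indicator_one hB, ← integral_indicator_one hC]
  refine prekopa_leindler_stdGaussian hl hm hlm (measurable_one.indicator hA)
    (measurable_one.indicator hB) (measurable_one.indicator hC) (i0 A) (i0 B) (i0 C)
    (i1 A) (i1 B) (i1 C) fun x y => ?_
  by_cases hx : x ∈ A
  · by_cases hy : y ∈ B
    · simp only [Set.indicator_of_mem hx, Set.indicator_of_mem hy, Pi.one_apply, Real.one_rpow,
        mul_one, one_mul, Set.indicator_of_mem (h x hx y hy)]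
      exact Real.exp_le_one_iff.2 (neg_nonpos.2 (by positivity))
    · simpa [hy, Real.zero_rpow hm.ne'] using i0 C _
  · simpa [hx, Real.zero_rpow hl.ne'] using i0 C _

/-- A quantitative form of midpoint log-concavity: there is a gain when a part of `A` is far
from `B`. -/
theorem stdGaussian_midpoint_le {A B C : Set (EuclideanSpace ℝ (Fin n))} {ε : ℝ} (hε : 0 < ε)
    (hA : MeasurableSet A) (hB : MeasurableSet B) (hC : MeasurableSet C)
    (h : ∀ x ∈ A, ∀ y ∈ B, (1 / 2 : ℝ) • x + (1 / 2 : ℝ) • y ∈ C) :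
    (stdGaussian (EuclideanSpace ℝ (Fin n))).real B *
      ((stdGaussian (EuclideanSpace ℝ (Fin n))).real A +
        ε ^ 2 / 4 * (stdGaussian (EuclideanSpace ℝ (Fin n))).real (A \ Metric.thickening ε B)) ≤
      (stdGaussian (EuclideanSpace ℝ (Fin n))).real C ^ 2 := by
  set γ := stdGaussian (EuclideanSpace ℝ (Fin n))
  have i0 : ∀ (S : Set (EuclideanSpace ℝ (Fin n))) x, (0 : ℝ) ≤ S.indicator 1 x :=
    fun S x => Set.indicator_nonneg (fun _ _ => zero_le_one) x
  have i1 : ∀ (S : Set (EuclideanSpace ℝ (Fin n))) x, S.indicator (1 : EuclideanSpace ℝ (Fin n) → ℝ) x ≤ 1 :=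
    fun S x => Set.indicator_le_self' (fun _ _ => zero_le_one) x
  have hT : MeasurableSet (A \ Metric.thickening ε B) :=
    hA.diff Metric.isOpen_thickening.measurableSet
  have mA : Measurable (A.indicator (1 : EuclideanSpace ℝ (Fin n) → ℝ)) := measurable_one.indicator hA
  have mT : Measurable ((A \ Metric.thickening ε B).indicator (1 : EuclideanSpace ℝ (Fin n) → ℝ)) :=
    measurable_one.indicator hT
  -- The extra weight `ε² / 4` on the distant part of `A` is affordable because `√(1 + ε²/4) ≤
  -- exp(ε²/8)`, while the Gaussian factor with `l = m = 1/2` is at most `exp(-ε²/8)` there.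
  have key := prekopa_leindler_stdGaussian (l := 1 / 2) (m := 1 / 2) (A := 1 + ε ^ 2 / 4 * 1)
    (B := 1) (D := 1)
    (f := fun x => A.indicator 1 x + ε ^ 2 / 4 * (A \ Metric.thickening ε B).indicator 1 x)
    (g := B.indicator 1) (h := C.indicator 1) (by norm_num) (by norm_num) (by norm_num)
    (mA.add (mT.const_mul _)) (measurable_one.indicator hB) (measurable_one.indicator hC)
    (fun x => add_nonneg (i0 _ _) (mul_nonneg (by positivity) (i0 _ _))) (i0 _) (i0 _)
    (fun x => add_le_add (i1 _ _) (mul_le_mul_of_nonneg_left (i1 _ _) (by positivity)))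
    (i1 _) (i1 _) (fun x y => by
      by_cases hx : x ∈ A
      · by_cases hy : y ∈ B
        · rw [Set.indicator_of_mem hx, Set.indicator_of_mem hy,
            Set.indicator_of_mem (h x hx y hy), ← Real.sqrt_eq_rpow, Pi.one_apply, Pi.one_apply,
            Pi.one_apply, Real.one_rpow, mul_one]
          by_cases hxT : x ∈ Metric.thickening ε B
          · have hn : x ∉ A \ Metric.thickening ε B := fun hx' => hx'.2 hxT
            rw [Set.indicator_of_notMem hn, mul_zero, add_zero, Real.sqrt_one, one_mul]
            exact Real.exp_le_one_iff.2 (neg_nonpos.2 (by positivity))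
          · have hd : ε ≤ ‖x - y‖ := by
              rw [← dist_eq_norm]
              by_contra! hlt
              exact hxT (Metric.mem_thickening_iff.2 ⟨y, hy, hlt⟩)
            have hn : x ∈ A \ Metric.thickening ε B := ⟨hx, hxT⟩
            rw [Set.indicator_of_mem hn, Pi.one_apply,
              mul_one, Real.exp_neg, ← div_eq_mul_inv, div_le_one (Real.exp_pos _)]
            refine Real.sqrt_le_iff.2 ⟨(Real.exp_pos _).le, ?_⟩
            rw [← Real.exp_nat_mul]
            have h1 := Real.add_one_le_exp (ε ^ 2 / 4)
            have h2 : ε ^ 2 ≤ ‖x - y‖ ^ 2 := pow_le_pow_left₀ hε.le hd 2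
            refine le_trans (by linarith) (Real.exp_le_exp.2 (?_ : ε ^ 2 / 4 ≤ _))
            push_cast
            linarith
        · simpa [hy] using i0 C _
      · have hn : x ∉ A \ Metric.thickening ε B := fun hx' => hx hx'.1
        simpa [hx, hn] using i0 C _)
  rw [integral_add, integral_const_mul, integral_indicator_one hA, integral_indicator_one hT,
    integral_indicator_one hB, integral_indicator_one hC, ← Real.sqrt_eq_rpow,
    ← Real.sqrt_eq_rpow, ← Real.sqrt_mul, Real.sqrt_le_left measureReal_nonneg, mul_comm] at key
  · exact key
  · positivity
  · exact integrable_of_nonneg_of_le mA (i0 _) (i1 _)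
  · exact (integrable_of_nonneg_of_le mT (i0 _) (i1 _)).const_mul _

/-! ### Halfspaces and the Gaussian measure near their boundaries. -/

lemma gaussianReal_zero_one_le_volume (S : Set ℝ) : gaussianReal 0 1 S ≤ volume S := by
  rw [gaussianReal_apply 0 one_ne_zero]
  calc ∫⁻ x in S, gaussianPDF 0 1 x ≤ ∫⁻ _ in S, 1 := by
        refine lintegral_mono fun x => ?_
        rw [gaussianPDF, ← ENNReal.ofReal_one]
        refine ENNReal.ofReal_le_ofReal ?_
        simp only [gaussianPDFReal, NNReal.coe_one, mul_one]
        refine mul_le_one₀ (inv_le_one_of_one_le₀ (Real.one_le_sqrt.2 ?_)) (Real.exp_pos _).le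
          (Real.exp_le_one_iff.2 ?_)
        · linarith [Real.pi_gt_three]
        · exact div_nonpos_of_nonpos_of_nonneg (neg_nonpos.2 (sq_nonneg _)) (by norm_num)
    _ = volume S := by simp

lemma gaussianReal_zero_one_real_Icc_le {a b : ℝ} (hab : a ≤ b) :
    (gaussianReal 0 1).real (Set.Icc a b) ≤ b - a := by
  refine ENNReal.toReal_le_of_le_ofReal (by linarith) ?_
  exact (gaussianReal_zero_one_le_volume _).trans (by simp)

lemma stdGaussian_map_inner {u : EuclideanSpace ℝ (Fin n)} (hu : ‖u‖ = 1) :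
    (stdGaussian (EuclideanSpace ℝ (Fin n))).map (fun x => ⟪u, x⟫) = gaussianReal 0 1 := by
  have := IsGaussian.map_eq_gaussianReal (μ := stdGaussian (EuclideanSpace ℝ (Fin n)))
    (innerSL ℝ u)
  rw [variance_dual_stdGaussian, integral_strongDual_stdGaussian, innerSL_apply_norm, hu] at this
  simpa using this

/-- The map that replaces the component of a vector in the direction `v` by `t`. -/
noncomputable def replaceComponent (v : EuclideanSpace ℝ (Fin n)) (t : ℝ)
    (x : EuclideanSpace ℝ (Fin n)) : EuclideanSpace ℝ (Fin n) :=
  x - ⟪v, x⟫ • v + t • v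

lemma continuous_replaceComponent (v : EuclideanSpace ℝ (Fin n)) :
    Continuous fun p : EuclideanSpace ℝ (Fin n) × ℝ => replaceComponent v p.2 p.1 := by
  unfold replaceComponent
  fun_prop

lemma IsHalfspace.measurableSet {H : Set (EuclideanSpace ℝ (Fin n))} (hH : IsHalfspace H) :
    MeasurableSet H := by
  obtain ⟨a, b, rfl | rfl⟩ := hH
  · exact measurableSet_le measurable_const (by fun_prop)
  · exact measurableSet_lt measurable_const (by fun_prop)

lemma IsHalfspace.convex {H : Set (EuclideanSpace ℝ (Fin n))} (hH : IsHalfspace H) :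
    Convex ℝ H := by
  obtain ⟨a, b, rfl | rfl⟩ := hH <;> intro x hx y hy s t hs ht hst <;>
    simp only [Set.mem_ofPred_eq, inner_add_right, inner_smul_right] at hx hy ⊢ <;>
    have hb : s * b + t * b = b := by rw [← add_mul, hst, one_mul]
  · nlinarith [mul_nonneg hs hx, mul_nonneg ht hy]
  · rcases hs.eq_or_lt with rfl | hs'
    · have : t = 1 := by linarith
      subst this
      linarith
    · nlinarith [mul_pos hs' hx, mul_nonneg ht hy.le]

/-- Slices of an intersection of `k` halfspaces are again such intersections, so the boundary
estimate applies to each slice with the same `k`. -/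
lemma IsHalfspace.preimage_replaceComponent {H : Set (EuclideanSpace ℝ (Fin n))}
    (hH : IsHalfspace H) (v : EuclideanSpace ℝ (Fin n)) (t : ℝ) :
    IsHalfspace (replaceComponent v t ⁻¹' H) := by
  obtain ⟨a, b, h⟩ := hH
  have e : ∀ x, ⟪a, replaceComponent v t x⟫ + b = ⟪a - ⟪a, v⟫ • v, x⟫ + (t * ⟪a, v⟫ + b) := by
    intro x
    simp only [replaceComponent, inner_add_right, inner_sub_right, inner_sub_left,
      inner_smul_right, inner_smul_left, RCLike.conj_to_real]
    ring
  refine ⟨a - ⟪a, v⟫ • v, t * ⟪a, v⟫ + b, h.imp ?_ ?_⟩ <;>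
  · rintro rfl
    ext x
    simp [e]

/-- The excess lies in a slab of width `ε` orthogonal to `a`. Projecting to the unit normal gives an
interval of length `ε`, and the one-dimensional Gaussian density is at most `1`. If `a = 0`, the
halfspace is empty or everything and there is no excess. -/
lemma IsHalfspace.measureReal_thickening_diff_le {H : Set (EuclideanSpace ℝ (Fin n))}
    (hH : IsHalfspace H) {ε : ℝ} (hε : 0 < ε) :
    (stdGaussian (EuclideanSpace ℝ (Fin n))).real (Metric.thickening ε H \ H) ≤ ε := by
  obtain ⟨a, b, h⟩ := hH
  have hout : ∀ x, x ∉ H → ⟪a, x⟫ + b ≤ 0 := by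
    intro x hx
    rcases h with rfl | rfl
    · exact (not_le.1 hx).le
    · exact not_lt.1 hx
  have hin : ∀ x ∈ H, 0 ≤ ⟪a, x⟫ + b := by
    intro x hx
    rcases h with rfl | rfl
    · exact hx
    · exact le_of_lt hx
  rcases eq_or_ne a 0 with rfl | ha
  · have : Metric.thickening ε H \ H = ∅ := by
      ext x
      simp only [Set.mem_sdiff, Metric.mem_thickening_iff, Set.mem_empty_iff_false, iff_false,
        not_and, not_not]
      rintro ⟨y, hy, -⟩
      rcases h with rfl | rfl <;> simpa using hy
    rw [this]
    simpa using hε.le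
  · have hna : 0 < ‖a‖ := norm_pos_iff.2 ha
    have hu : ‖(‖a‖⁻¹ • a)‖ = 1 := by
      rw [norm_smul, norm_inv, norm_norm, inv_mul_cancel₀ hna.ne']
    have hsub : Metric.thickening ε H \ H ⊆
        (fun x => ⟪‖a‖⁻¹ • a, x⟫) ⁻¹' Set.Icc (-(b / ‖a‖) - ε) (-(b / ‖a‖)) := by
      rintro x ⟨hx, hxH⟩
      obtain ⟨y, hy, hxy⟩ := Metric.mem_thickening_iff.1 hx
      have h1 := hout x hxH
      have h2 := hin y hy
      have h3 : ⟪a, y - x⟫ ≤ ‖a‖ * ε := (real_inner_le_norm _ _).trans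
        (mul_le_mul_of_nonneg_left (by rw [← dist_eq_norm, dist_comm]; exact hxy.le) hna.le)
      rw [inner_sub_right] at h3
      simp only [Set.mem_preimage, Set.mem_Icc, inner_smul_left, RCLike.conj_to_real]
      have e : ‖a‖⁻¹ * ⟪a, x⟫ = ⟪a, x⟫ / ‖a‖ := by rw [div_eq_inv_mul]
      rw [e, neg_sub_left, ← neg_div, neg_le, ← neg_div, div_le_iff₀ hna,
        div_le_div_iff_of_pos_right hna, add_mul, div_mul_cancel₀ _ hna.ne']
      constructor <;> linarith
    calc (stdGaussian (EuclideanSpace ℝ (Fin n))).real (Metric.thickening ε H \ H)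
        ≤ _ := measureReal_mono hsub
      _ = (gaussianReal 0 1).real (Set.Icc (-(b / ‖a‖) - ε) (-(b / ‖a‖))) := by
          rw [← stdGaussian_map_inner hu, map_measureReal_apply (by fun_prop) measurableSet_Icc]
      _ ≤ ε := (gaussianReal_zero_one_real_Icc_le (by linarith)).trans (by linarith)

/-- A dimension-free bound on the Gaussian measure of the neighbourhood of the boundary of an
intersection of `k` halfspaces. -/
lemma measureReal_thickening_iInter_diff_le {k : ℕ} {H : Fin k → Set (EuclideanSpace ℝ (Fin n))}
    (hH : ∀ i, IsHalfspace (H i)) {ε : ℝ} (hε : 0 < ε) :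
    (stdGaussian (EuclideanSpace ℝ (Fin n))).real (Metric.thickening ε (⋂ i, H i) \ ⋂ i, H i)
      ≤ k * ε := by
  have hsub : Metric.thickening ε (⋂ i, H i) \ ⋂ i, H i ⊆
      ⋃ i, (Metric.thickening ε (H i) \ H i) := by
    rintro x ⟨hx, hxH⟩
    obtain ⟨i, hi⟩ := not_forall.1 (fun h => hxH (Set.mem_iInter.2 h))
    exact Set.mem_iUnion.2
      ⟨i, Metric.thickening_subset_of_subset ε (Set.iInter_subset _ i) hx, hi⟩
  calc _ ≤ (stdGaussian (EuclideanSpace ℝ (Fin n))).real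
          (⋃ i, (Metric.thickening ε (H i) \ H i)) := measureReal_mono hsub
    _ ≤ ∑ i, (stdGaussian (EuclideanSpace ℝ (Fin n))).real (Metric.thickening ε (H i) \ H i) :=
        measureReal_iUnion_fintype_le _
    _ ≤ ∑ _i : Fin k, ε := Finset.sum_le_sum fun i _ => (hH i).measureReal_thickening_diff_le hε
    _ = k * ε := by simp

/-! ### Quadratic test polynomials and quasiconcave functions on the line. -/

lemma integrable_pow_gaussianReal (k : ℕ) : Integrable (fun t => t ^ k) (gaussianReal 0 1) := by
  have := (memLp_id_gaussianReal' (μ := 0) (v := 1) k (by simp)).integrable_norm_pow'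
  refine this.mono' (by fun_prop) (Filter.Eventually.of_forall fun t => ?_)
  simp

lemma integrable_polynomial_gaussianReal (p : Polynomial ℝ) :
    Integrable (fun t => p.eval t) (gaussianReal 0 1) := by
  simp_rw [Polynomial.eval_eq_sum_range]
  exact integrable_finsetSum _ fun i _ => (integrable_pow_gaussianReal i).const_mul _

/-- The moments are the derivatives at `0` of the moment generating function `exp(t²/2)`. -/
lemma gaussianReal_moments : ∫ t, t ∂(gaussianReal 0 1) = 0 ∧ ∫ t, t ^ 2 ∂(gaussianReal 0 1) = 1 ∧
    ∫ t, t ^ 3 ∂(gaussianReal 0 1) = 0 ∧ ∫ t, t ^ 4 ∂(gaussianReal 0 1) = 3 := by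
  have hm : mgf (fun x => x) (gaussianReal 0 1) = fun t => Real.exp (t ^ 2 / 2) := by
    rw [mgf_fun_id_gaussianReal]; simp
  have he : ∀ t : ℝ, HasDerivAt (fun t => Real.exp (t ^ 2 / 2)) (t * Real.exp (t ^ 2 / 2)) t := by
    intro t
    refine ((((hasDerivAt_id' t).fun_pow 2).div_const 2).exp).congr_deriv ?_
    push_cast
    ring
  have d1 : deriv (fun t : ℝ => Real.exp (t ^ 2 / 2)) = fun t => t * Real.exp (t ^ 2 / 2) :=
    funext fun t => (he t).deriv
  have d2 : deriv (fun t : ℝ => t * Real.exp (t ^ 2 / 2)) =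
      fun t => (1 + t ^ 2) * Real.exp (t ^ 2 / 2) := by
    ext t
    rw [((hasDerivAt_id' t).fun_mul (he t)).deriv]
    ring
  have d3 : deriv (fun t : ℝ => (1 + t ^ 2) * Real.exp (t ^ 2 / 2)) =
      fun t => (3 * t + t ^ 3) * Real.exp (t ^ 2 / 2) := by
    ext t
    rw [((((hasDerivAt_id' t).fun_pow 2).const_add 1).fun_mul (he t)).deriv]
    push_cast
    ring
  have d4 : deriv (fun t : ℝ => (3 * t + t ^ 3) * Real.exp (t ^ 2 / 2)) =
      fun t => (3 + 6 * t ^ 2 + t ^ 4) * Real.exp (t ^ 2 / 2) := by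
    ext t
    rw [((((hasDerivAt_id' t).const_mul 3).fun_add ((hasDerivAt_id' t).fun_pow 3)).fun_mul (he t)).deriv]
    push_cast
    ring
  have key : ∀ k : ℕ, ∫ t, t ^ k ∂(gaussianReal 0 1) =
      iteratedDeriv k (fun t : ℝ => Real.exp (t ^ 2 / 2)) 0 := by
    intro k
    rw [← hm, iteratedDeriv_mgf_zero (by simp)]
    rfl
  refine ⟨by simp, ?_, ?_, ?_⟩ <;>
    simp [key, iteratedDeriv_succ, iteratedDeriv_zero, d1, d2, d3, d4]

/-- With `c = a - a⁻¹` the quadratic is `(t - a)(t + a⁻¹)`; the second integral supplies its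
normalisation. -/
lemma integral_gaussianReal_quadratic (c : ℝ) :
    ∫ t, (t ^ 2 - c * t - 1) ∂(gaussianReal 0 1) = 0 ∧
    ∫ t, (t ^ 2 - c * t - 1) ^ 2 ∂(gaussianReal 0 1) = 2 + c ^ 2 := by
  obtain ⟨m1, m2, m3, m4⟩ := gaussianReal_moments
  have i1 : Integrable (fun t => t) (gaussianReal 0 1) := by
    simpa using integrable_pow_gaussianReal 1
  have i2 := integrable_pow_gaussianReal 2
  have i3 := integrable_pow_gaussianReal 3
  have i4 := integrable_pow_gaussianReal 4
  constructor
  · rw [integral_sub (by exact i2.sub (i1.const_mul c)) (integrable_const _),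
      integral_sub i2 (i1.const_mul c), integral_const_mul, m1, m2]
    simp
  · have e : ∀ t : ℝ, (t ^ 2 - c * t - 1) ^ 2 =
        t ^ 4 + (-(2 * c)) * t ^ 3 + (c ^ 2 - 2) * t ^ 2 + (2 * c) * t + 1 := fun t => by ring
    simp_rw [e]
    have j1 := i4.add (i3.const_mul (-(2 * c)))
    have j2 := j1.add (i2.const_mul (c ^ 2 - 2))
    have j3 := j2.add (i1.const_mul (2 * c))
    rw [integral_add (by exact j3) (integrable_const _), integral_add (by exact j2)
      (i1.const_mul _), integral_add (by exact j1) (i2.const_mul _), integral_add i4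
      (i3.const_mul _), integral_const_mul, integral_const_mul, integral_const_mul, m1, m2, m3, m4]
    simp
    ring

/-- The supremum of `F` over `T` separates the values. Here `S` will be the side where the test
polynomial is negative and `T` the side where it is positive. -/
lemma exists_threshold {F : ℝ → ℝ} (hF0 : ∀ t, 0 ≤ F t) (hF1 : ∀ t, F t ≤ 1) {S T : Set ℝ}
    (hT : T.Nonempty) (h : ∀ x ∈ S, ∀ y ∈ T, F y ≤ F x) :
    ∃ c, 0 ≤ c ∧ c ≤ 1 ∧ (∀ x ∈ S, c ≤ F x) ∧ ∀ y ∈ T, F y ≤ c := by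
  have hb : BddAbove (F '' T) := ⟨1, by rintro _ ⟨y, -, rfl⟩; exact hF1 y⟩
  obtain ⟨y, hy⟩ := hT
  refine ⟨sSup (F '' T), ?_, ?_, ?_, ?_⟩
  · exact (hF0 y).trans (le_csSup hb ⟨y, hy, rfl⟩)
  · exact csSup_le ⟨_, y, hy, rfl⟩ (by rintro _ ⟨y, -, rfl⟩; exact hF1 y)
  · intro x hx
    exact csSup_le ⟨_, y, hy, rfl⟩ (by rintro _ ⟨y, hy, rfl⟩; exact h x hx y hy)
  · intro y hy
    exact le_csSup hb ⟨y, hy, rfl⟩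

/-- A quasiconcave function on the line has a superlevel set whose endpoints are the roots of a
quadratic polynomial of mean zero under the Gaussian measure. -/
lemma exists_polynomial_threshold {F : ℝ → ℝ} (hF0 : ∀ t, 0 ≤ F t) (hF1 : ∀ t, F t ≤ 1)
    (hF : ∀ x y z, x ≤ y → y ≤ z → min (F x) (F z) ≤ F y) :
    ∃ (p : Polynomial ℝ) (c a b : ℝ), p.natDegree ≤ 2 ∧
      ∫ t, p.eval t ∂(gaussianReal 0 1) = 0 ∧ ∫ t, (p.eval t) ^ 2 ∂(gaussianReal 0 1) = 1 ∧
      0 ≤ c ∧ c ≤ 1 ∧ (∀ t, t ≠ a → t ≠ b → (F t - c) * p.eval t ≤ 0) ∧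
      ∀ t, min |t - a| |t - b| / 2 ≤ |p.eval t| := by
  have m2 := gaussianReal_moments.2.1
  -- The candidate intervals are `(-1/r, r)`, and `U` collects the `r` where the right endpoint has
  -- a smaller value than the left. At the infimum of `U` the two endpoints balance, and that
  -- interval serves as the superlevel set.
  set U : Set ℝ := {a | 0 < a ∧ F a < F (-a⁻¹)} with hU
  -- As `-1/y` is not in `U`, `F y ≤ F (-1/y)`, and quasiconcavity gives `F ≥ F y` on `[y, -1/y]`. A
  -- point `x` further right is reached through `-1/x`, which lies in that interval, because `x` is
  -- not in `U`.
  have hlow : ∀ y < 0, (∀ r, 0 < r → r ≤ -y⁻¹ → r ∉ U) →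
      ∀ x, y < x → (∀ r, 0 < r → r ≤ x → r ∉ U) → F y ≤ F x := by
    intro y hy hyU x hyx hxU
    have hc : 0 < -y⁻¹ := neg_pos.2 (inv_lt_zero.2 hy)
    have h1 : F y ≤ F (-y⁻¹) := by
      have := fun h => hyU _ hc le_rfl ⟨hc, h⟩
      simpa using this
    rcases le_or_gt x (-y⁻¹) with hx | hx
    · exact (le_min le_rfl h1).trans (hF y x _ hyx.le hx)
    · have hx0 : 0 < x := hc.trans hx
      have h2 : F (-x⁻¹) ≤ F x := not_lt.1 fun h => hxU x hx0 le_rfl ⟨hx0, h⟩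
      refine le_trans ((le_min le_rfl h1).trans (hF y (-x⁻¹) _ ?_ ?_)) h2
      · have : x⁻¹ < (-y⁻¹)⁻¹ := inv_strictAnti₀ hc hx
        rw [inv_neg, inv_inv] at this
        linarith
      · linarith [inv_pos.2 hx0]
  -- Since `F r < F (-1/r)`, quasiconcavity makes `F` at most `F r` beyond `r` and at least `F r` on
  -- `[-1/r, r]`.
  have hhigh : ∀ r ∈ U, ∀ y, r < y → ∀ x, -r⁻¹ < x → x ≤ r → F y ≤ F x := by
    rintro r ⟨hr0, hr⟩ y hy x hx hxr
    have h1 : F y ≤ F r := by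
      have := hF (-r⁻¹) r y (by linarith [inv_pos.2 hr0]) hy.le
      rcases min_le_iff.1 this with h | h
      · exact absurd h (not_le.2 hr)
      · exact h
    refine h1.trans ((le_min hr.le le_rfl).trans (hF _ x r hx.le hxr))
  -- Empty `U` is the limit `a = ∞`, with interval `(0, ∞)` and polynomial `-X`; infimum `0` gives
  -- `(-∞, 0)` and `X`.
  rcases U.eq_empty_or_nonempty with hUe | hUne
  · obtain ⟨c, hc0, hc1, hS, hT⟩ := exists_threshold hF0 hF1 (S := Set.Ioi 0) (T := Set.Iio 0)
      ⟨-1, by simp⟩ (fun x hx y hy => hlow y hy (fun r _ _ => by simp [hUe]) x (hy.trans hx)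
        (fun r _ _ => by simp [hUe]))
    refine ⟨-Polynomial.X, c, 0, 0, by simp, ?_, by simpa using m2, hc0, hc1, ?_, ?_⟩
    · simp only [Polynomial.eval_neg, Polynomial.eval_X]
      rw [MeasureTheory.integral_neg]
      simp
    · intro t ht _
      rcases lt_or_gt_of_ne ht with h | h
      · have := hT t h
        simp only [Polynomial.eval_neg, Polynomial.eval_X]
        nlinarith
      · have := hS t h
        simp only [Polynomial.eval_neg, Polynomial.eval_X]
        nlinarith
    · intro t
      simp
  have hUb : BddBelow U := ⟨0, fun a ha => ha.1.le⟩
  have h0 : 0 ≤ sInf U := le_csInf hUne fun a ha => ha.1.le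
  have hlt : ∀ s, sInf U < s → ∃ r ∈ U, r < s := fun s hs => exists_lt_of_csInf_lt hUne hs
  have hnot : ∀ r, r < sInf U → r ∉ U := fun r hr => notMem_of_lt_csInf hr hUb
  have hge : ∀ r ∈ U, sInf U ≤ r := fun r hr => csInf_le hUb hr
  set a := sInf U with ha
  rcases h0.eq_or_lt with h0 | h0
  · obtain ⟨c, hc0, hc1, hS, hT⟩ := exists_threshold hF0 hF1 (S := Set.Iio 0) (T := Set.Ioi 0)
      ⟨1, by simp⟩ (fun x hx y hy => by
        have hx' : 0 < -x⁻¹ := neg_pos.2 (inv_lt_zero.2 hx)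
        obtain ⟨r, hr, hrs⟩ := hlt (min y (-x⁻¹)) (by rw [← h0]; exact lt_min hy hx')
        refine hhigh r hr y (hrs.trans_le (min_le_left _ _)) x ?_ (hx.le.trans hr.1.le)
        have := inv_strictAnti₀ hr.1 (hrs.trans_le (min_le_right _ _))
        rw [inv_neg, inv_inv] at this
        linarith)
    refine ⟨Polynomial.X, c, 0, 0, by simp, by simp, by simpa using m2, hc0, hc1, ?_, ?_⟩
    · intro t ht _
      rcases lt_or_gt_of_ne ht with h | h
      · have := hS t h
        simp only [Polynomial.eval_X]
        nlinarith
      · have := hT t h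
        simp only [Polynomial.eval_X]
        nlinarith
    · intro t
      simp
  · have hai : 0 < a⁻¹ := inv_pos.2 h0
    have haa : a * a⁻¹ = 1 := mul_inv_cancel₀ h0.ne'
    obtain ⟨c, hc0, hc1, hS, hT⟩ := exists_threshold hF0 hF1 (S := Set.Ioo (-a⁻¹) a)
      (T := {y | y < -a⁻¹ ∨ a < y}) ⟨a + 1, Or.inr (by simp)⟩ (fun x hx y hy => by
        rcases hy with hy | hy
        · have hy0 : y < 0 := hy.trans (by linarith)
          have e : -y⁻¹ < a := by
            have := inv_strictAnti₀ hai (lt_neg.1 hy)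
            rwa [inv_neg, inv_inv] at this
          exact hlow y hy0 (fun r _ hr => hnot r (hr.trans_lt e)) x (hy.trans hx.1)
            (fun r _ hr => hnot r (hr.trans_lt hx.2))
        · rcases lt_or_ge x 0 with hx0 | hx0
          · have hx' : 0 < -x := neg_pos.2 hx0
            have e : a < -x⁻¹ := by
              have := inv_strictAnti₀ hx' (neg_lt.1 hx.1)
              rwa [inv_neg, inv_inv] at this
            obtain ⟨r, hr, hrs⟩ := hlt (min y (-x⁻¹)) (lt_min hy e)
            refine hhigh r hr y (hrs.trans_le (min_le_left _ _)) x ?_ (hx0.le.trans hr.1.le)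
            have := inv_strictAnti₀ hr.1 (hrs.trans_le (min_le_right _ _))
            rw [inv_neg, inv_inv] at this
            linarith
          · obtain ⟨r, hr, hrs⟩ := hlt y hy
            refine hhigh r hr y hrs x ?_ (hx.2.le.trans (hge r hr))
            linarith [inv_pos.2 hr.1])
    set s := √(2 + (a - a⁻¹) ^ 2) with hs
    have hs0 : 0 < s := by positivity
    have hs2 : s ^ 2 = 2 + (a - a⁻¹) ^ 2 := Real.sq_sqrt (by positivity)
    -- Indeed `s² = a² + a⁻²`; so the normalising constant is at most the distance between the
    -- roots.
    have hsle : s ≤ a + a⁻¹ := abs_le_of_sq_le_sq' (by nlinarith) (by positivity) |>.2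
    have hev : ∀ t, (Polynomial.C s⁻¹ *
        (Polynomial.X ^ 2 - Polynomial.C (a - a⁻¹) * Polynomial.X - 1)).eval t =
        s⁻¹ * (t ^ 2 - (a - a⁻¹) * t - 1) := by
      intro t; simp
    have hfac : ∀ t, t ^ 2 - (a - a⁻¹) * t - 1 = (t - a) * (t - -a⁻¹) := by
      intro t
      linear_combination haa
    obtain ⟨q1, q2⟩ := integral_gaussianReal_quadratic (a - a⁻¹)
    refine ⟨Polynomial.C s⁻¹ * (Polynomial.X ^ 2 - Polynomial.C (a - a⁻¹) * Polynomial.X - 1), c,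
      a, -a⁻¹, by compute_degree, ?_, ?_, hc0, hc1, ?_, ?_⟩
    · simp_rw [hev, integral_const_mul, q1, mul_zero]
    · simp_rw [hev, mul_pow, integral_const_mul, q2, ← hs2, ← mul_pow]
      rw [inv_mul_cancel₀ hs0.ne', one_pow]
    · intro t ht1 ht2
      rw [hev, hfac, mul_left_comm]
      refine mul_nonpos_of_nonneg_of_nonpos (inv_pos.2 hs0).le ?_
      rcases lt_or_gt_of_ne ht2 with h2 | h2
      · have := hT t (Or.inl h2)
        refine mul_nonpos_of_nonpos_of_nonneg (by linarith) (mul_nonneg_of_nonpos_of_nonpos ?_ ?_)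
          <;> linarith
      rcases lt_or_gt_of_ne ht1 with h1 | h1
      · have := hS t ⟨h2, h1⟩
        refine mul_nonpos_of_nonneg_of_nonpos (by linarith)
          (mul_nonpos_of_nonpos_of_nonneg ?_ ?_) <;> linarith
      · have := hT t (Or.inr h1)
        refine mul_nonpos_of_nonpos_of_nonneg (by linarith) (mul_nonneg ?_ ?_) <;> linarith
    · intro t
      rw [hev, hfac, abs_mul, abs_mul, abs_of_pos (inv_pos.2 hs0), ← div_eq_inv_mul,
        le_div_iff₀ hs0]
      -- The distances from `t` to the two roots sum to at least `s`, so the larger is at least `s /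
      -- 2`, leaving half the smaller one after division by `s`.
      have tri : a + a⁻¹ ≤ |t - a| + |t - -a⁻¹| := by
        have e : |(t - -a⁻¹) - (t - a)| = a + a⁻¹ := by
          rw [show (t - -a⁻¹) - (t - a) = a + a⁻¹ by ring, abs_of_pos (by positivity)]
        have := abs_sub (t - -a⁻¹) (t - a)
        linarith
      have p1 := abs_nonneg (t - a)
      have p2 := abs_nonneg (t - -a⁻¹)
      rcases le_total |t - a| |t - -a⁻¹| with h | h
      · rw [min_eq_left h]
        nlinarith
      · rw [min_eq_right h]
        nlinarith

/-- Stability: a quasiconcave function that is almost uncorrelated with all quadratic polynomials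
of mean zero is close to a constant. -/
lemma exists_integral_abs_sub_le {F : ℝ → ℝ} {δ : ℝ} (hδ : 0 < δ) (hFm : Measurable F)
    (hF0 : ∀ t, 0 ≤ F t) (hF1 : ∀ t, F t ≤ 1)
    (hF : ∀ x y z, x ≤ y → y ≤ z → min (F x) (F z) ≤ F y)
    (hp : ∀ p : Polynomial ℝ, p.natDegree ≤ 2 → ∫ t, p.eval t ∂(gaussianReal 0 1) = 0 →
      ∫ t, (p.eval t) ^ 2 ∂(gaussianReal 0 1) = 1 →
      |∫ t, F t * p.eval t ∂(gaussianReal 0 1)| < δ) :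
    ∃ c, 0 ≤ c ∧ c ≤ 1 ∧ ∫ t, |F t - c| ∂(gaussianReal 0 1) ≤ 9 * √δ := by
  obtain ⟨p, c, a, b, hdeg, hp0, hp1, hc0, hc1, hsign, hmin⟩ :=
    exists_polynomial_threshold hF0 hF1 hF
  refine ⟨c, hc0, hc1, ?_⟩
  have hna : ∀ d, ∀ᵐ t ∂(gaussianReal 0 1), t ≠ d := fun d => by
    have : (gaussianReal 0 1) {d} = 0 :=
      nonpos_iff_eq_zero.1 ((gaussianReal_zero_one_le_volume {d}).trans (by simp))
    simpa [ae_iff] using this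
  set ρ := √δ with hρ
  have hρ0 : 0 < ρ := Real.sqrt_pos.2 hδ
  have hρ2 : ρ ^ 2 = δ := Real.sq_sqrt hδ.le
  have hpi := integrable_polynomial_gaussianReal p
  have hFp : Integrable (fun t => F t * p.eval t) (gaussianReal 0 1) :=
    hpi.bdd_mul (c := 1) hFm.aestronglyMeasurable (Filter.Eventually.of_forall fun t => by
      rw [Real.norm_of_nonneg (hF0 t)]; exact hF1 t)
  have hi : Integrable (fun t => (c - F t) * p.eval t) (gaussianReal 0 1) := by
    simp_rw [sub_mul]
    exact (hpi.const_mul c).sub hFp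
  have h1 : ∫ t, (c - F t) * p.eval t ∂(gaussianReal 0 1) ≤ δ := by
    simp_rw [sub_mul]
    rw [integral_sub (hpi.const_mul c) hFp, integral_const_mul, hp0, mul_zero, zero_sub]
    exact (neg_le_abs _).trans (hp p hdeg hp0 hp1).le
  have mI : ∀ d : ℝ, MeasurableSet (Set.Icc (d - 2 * ρ) (d + 2 * ρ)) := fun d => measurableSet_Icc
  have iI : ∀ d : ℝ, Integrable ((Set.Icc (d - 2 * ρ) (d + 2 * ρ)).indicator (1 : ℝ → ℝ))
      (gaussianReal 0 1) := fun d => (integrable_const (1 : ℝ)).indicator (mI d)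
  have nI : ∀ d t : ℝ, 0 ≤ (Set.Icc (d - 2 * ρ) (d + 2 * ρ)).indicator (1 : ℝ → ℝ) t :=
    fun d t => Set.indicator_nonneg (fun _ _ => zero_le_one) t
  have h2 : ∀ d : ℝ, ∫ t, (Set.Icc (d - 2 * ρ) (d + 2 * ρ)).indicator (1 : ℝ → ℝ) t
      ∂(gaussianReal 0 1) ≤ 4 * ρ := fun d => by
    rw [integral_indicator_one (mI d)]
    exact (gaussianReal_zero_one_real_Icc_le (by linarith)).trans (by linarith)
  -- Outside the intervals of radius `2ρ` about the roots `|p| ≥ ρ`, so `|F - c| ≤ ρ⁻¹ (c - F) p`;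
  -- inside, `|F - c| ≤ 1`. The cost is `δ/ρ + 4ρ + 4ρ`, which is `9ρ` since `ρ² = δ`.
  calc ∫ t, |F t - c| ∂(gaussianReal 0 1)
      ≤ ∫ t, (ρ⁻¹ * ((c - F t) * p.eval t) +
          (Set.Icc (a - 2 * ρ) (a + 2 * ρ)).indicator 1 t +
          (Set.Icc (b - 2 * ρ) (b + 2 * ρ)).indicator 1 t) ∂(gaussianReal 0 1) := by
        refine integral_mono_of_nonneg (Filter.Eventually.of_forall fun t => abs_nonneg _)
          (((hi.const_mul _).add (iI a)).add (iI b)) ?_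
        filter_upwards [hna a, hna b] with t hta htb
        have hs := hsign t hta htb
        have e : (c - F t) * p.eval t = |F t - c| * |p.eval t| := by
          rw [← abs_mul, abs_of_nonpos hs]; ring
        rw [e]
        have hbd : |F t - c| ≤ 1 := abs_le.2 ⟨by linarith [hF0 t], by linarith [hF1 t]⟩
        have hpos : 0 ≤ ρ⁻¹ * (|F t - c| * |p.eval t|) := by positivity
        by_cases h1 : t ∈ Set.Icc (a - 2 * ρ) (a + 2 * ρ)
        · rw [Set.indicator_of_mem h1, Pi.one_apply]
          linarith [nI b t]
        by_cases h2 : t ∈ Set.Icc (b - 2 * ρ) (b + 2 * ρ)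
        · rw [Set.indicator_of_mem h2, Pi.one_apply]
          linarith [nI a t]
        have out : ∀ d : ℝ, t ∉ Set.Icc (d - 2 * ρ) (d + 2 * ρ) → 2 * ρ ≤ |t - d| := by
          intro d hd
          by_contra! hlt
          obtain ⟨l1, l2⟩ := abs_lt.1 hlt
          exact hd ⟨by linarith, by linarith⟩
        have hpt : ρ ≤ |p.eval t| := by
          have := le_min (out a h1) (out b h2)
          linarith [hmin t]
        have : |F t - c| ≤ ρ⁻¹ * (|F t - c| * |p.eval t|) := by
          rw [le_inv_mul_iff₀ hρ0, mul_comm]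
          exact mul_le_mul_of_nonneg_left hpt (abs_nonneg _)
        linarith [nI a t, nI b t]
    _ ≤ ρ⁻¹ * δ + 4 * ρ + 4 * ρ := by
        rw [integral_add (by exact (hi.const_mul _).add (iI a)) (iI b),
          integral_add (hi.const_mul _) (iI a), integral_const_mul]
        exact add_le_add (add_le_add (mul_le_mul_of_nonneg_left h1 (inv_pos.2 hρ0).le) (h2 a)) (h2 b)
    _ = 9 * ρ := by
        rw [← hρ2]
        field_simp
        ring

/-- Otherwise `u ≥ 2J (1 - t²/4)` everywhere, and the right side has mean `3J/2 > J`. The bound on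
`s` is needed to compare the law of `(t + s)/2` with the Gaussian. -/
lemma exists_abs_sub_le_of_integral {u : ℝ → ℝ} {J : ℝ} (hJ : 0 < J) (hu0 : ∀ t, 0 ≤ u t)
    (hui : Integrable u (gaussianReal 0 1)) (hu : ∫ t, u t ∂(gaussianReal 0 1) ≤ J) :
    ∃ s, |s| ≤ 2 ∧ u s ≤ 2 * J := by
  by_contra! h
  have h2 := integrable_pow_gaussianReal 2
  have : ∫ t, 2 * J * (1 - t ^ 2 / 4) ∂(gaussianReal 0 1) ≤ ∫ t, u t ∂(gaussianReal 0 1) := by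
    refine integral_mono (((integrable_const 1).sub (h2.div_const 4)).const_mul _) hui fun t => ?_
    rcases le_or_gt |t| 2 with ht | ht
    · exact le_trans (by nlinarith [sq_nonneg t]) (h t ht).le
    · refine le_trans ?_ (hu0 t)
      have : 2 ^ 2 < |t| ^ 2 := pow_lt_pow_left₀ ht (by norm_num) (by norm_num)
      rw [sq_abs] at this
      exact mul_nonpos_of_nonneg_of_nonpos (by linarith) (by linarith)
  rw [integral_const_mul, integral_sub (integrable_const _) (h2.div_const 4), integral_div,
    gaussianReal_moments.2.1] at this
  simp at this
  linarith

/-- The law of `(t + s)/2` has density `2 φ(2x - s)`, and for `|s| ≤ 2` completing the square gives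
`φ(2x - s) ≤ e φ(x) ≤ 3 φ(x)`. -/
lemma integral_midpoint_gaussianReal_le {u : ℝ → ℝ} {s M : ℝ} (hs : |s| ≤ 2) (hum : Measurable u)
    (hu0 : ∀ t, 0 ≤ u t) (huM : ∀ t, u t ≤ M) :
    ∫ t, u ((t + s) / 2) ∂(gaussianReal 0 1) ≤ 6 * ∫ t, u t ∂(gaussianReal 0 1) := by
  set φ := gaussianPDFReal 0 1 with hφ
  have hφ' : ∀ x, φ x = (√(2 * Real.pi))⁻¹ * Real.exp (-(x ^ 2 / 2)) := by
    intro x; simp [hφ, gaussianPDFReal, neg_div]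
  have hφ0 : ∀ x, 0 ≤ φ x := gaussianPDFReal_nonneg 0 1
  have hint : Integrable fun x => φ x * u x := by
    refine (integrable_gaussianPDFReal 0 1).mul_bdd (c := M) hum.aestronglyMeasurable ?_
    filter_upwards with x
    rw [Real.norm_of_nonneg (hu0 x)]
    exact huM x
  have hconv : ∀ F : ℝ → ℝ, ∫ x, F x ∂(gaussianReal 0 1) = ∫ x, φ x * F x := by
    intro F
    rw [integral_gaussianReal_eq_integral_smul one_ne_zero]
    simp [hφ]
  rw [hconv, hconv]
  set g : ℝ → ℝ := fun x => φ (2 * x - s) * u x with hg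
  have e1 : ∫ t, φ t * u ((t + s) / 2) = ∫ t, g ((t + s) / 2) := by
    congr 1
    ext t
    simp only [hg]
    congr 2
    ring
  have e2 : ∫ t, g ((t + s) / 2) = 2 * ∫ t, g t := by
    rw [integral_add_right_eq_self (fun t => g (t / 2)) s, Measure.integral_comp_div]
    simp
  have e3 : ∫ t, g t ≤ ∫ t, 3 * (φ t * u t) := by
    refine integral_mono_of_nonneg
      (Filter.Eventually.of_forall fun t => mul_nonneg (hφ0 _) (hu0 _)) (hint.const_mul 3)
      (Filter.Eventually.of_forall fun t => ?_)
    simp only [hg]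
    rw [← mul_assoc]
    refine mul_le_mul_of_nonneg_right ?_ (hu0 t)
    have hs2 : s ^ 2 ≤ 4 := by
      have := pow_le_pow_left₀ (abs_nonneg s) hs 2
      rw [sq_abs] at this
      linarith
    have h3 : Real.exp 1 ≤ 3 := by linarith [Real.exp_one_lt_d9]
    rw [hφ', hφ', mul_left_comm]
    refine mul_le_mul_of_nonneg_left ?_ (by positivity)
    calc Real.exp (-((2 * t - s) ^ 2 / 2)) ≤ Real.exp (1 + -(t ^ 2 / 2)) :=
          Real.exp_le_exp.2 (by nlinarith [sq_nonneg (3 * t - 2 * s)])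
      _ = Real.exp 1 * Real.exp (-(t ^ 2 / 2)) := Real.exp_add _ _
      _ ≤ _ := mul_le_mul_of_nonneg_right h3 (Real.exp_pos _).le
  rw [integral_const_mul] at e3
  rw [e1, e2]
  linarith

/-- A version of `exists_integral_abs_sub_le` where the constant is a value of the function. -/
lemma exists_center {F : ℝ → ℝ} {δ : ℝ} (hδ : 0 < δ) (hFm : Measurable F)
    (hF0 : ∀ t, 0 ≤ F t) (hF1 : ∀ t, F t ≤ 1)
    (hF : ∀ x y z, x ≤ y → y ≤ z → min (F x) (F z) ≤ F y)
    (hp : ∀ p : Polynomial ℝ, p.natDegree ≤ 2 → ∫ t, p.eval t ∂(gaussianReal 0 1) = 0 →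
      ∫ t, (p.eval t) ^ 2 ∂(gaussianReal 0 1) = 1 →
      |∫ t, F t * p.eval t ∂(gaussianReal 0 1)| < δ) :
    ∃ s, ∫ t, |F t - F s| ∂(gaussianReal 0 1) ≤ 27 * √δ ∧
      ∫ t, |F ((t + s) / 2) - F s| ∂(gaussianReal 0 1) ≤ 6 * (27 * √δ) := by
  obtain ⟨c, hc0, hc1, hc⟩ := exists_integral_abs_sub_le hδ hFm hF0 hF1 hF hp
  have hm : ∀ d, Measurable fun t => |F t - d| := fun d => (hFm.sub_const d).abs
  have hb : ∀ d, 0 ≤ d → d ≤ 1 → ∀ t, |F t - d| ≤ 1 := fun d h0 h1 t =>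
    abs_le.2 ⟨by linarith [hF0 t], by linarith [hF1 t]⟩
  have hi : ∀ d, 0 ≤ d → d ≤ 1 → Integrable (fun t => |F t - d|) (gaussianReal 0 1) :=
    fun d h0 h1 => integrable_of_nonneg_of_le (hm d) (fun _ => abs_nonneg _) (hb d h0 h1)
  have hδ' := Real.sqrt_pos.2 hδ
  obtain ⟨s, hs, hsc⟩ := exists_abs_sub_le_of_integral (u := fun t => |F t - c|)
    (J := 9 * √δ) (by positivity) (fun _ => abs_nonneg _) (hi c hc0 hc1) hc
  have h1 : ∫ t, |F t - F s| ∂(gaussianReal 0 1) ≤ 27 * √δ := by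
    calc ∫ t, |F t - F s| ∂(gaussianReal 0 1)
        ≤ ∫ t, (|F t - c| + 2 * (9 * √δ)) ∂(gaussianReal 0 1) := by
          refine integral_mono (hi _ (hF0 s) (hF1 s)) ((hi c hc0 hc1).add (integrable_const _))
            fun t => ?_
          have := abs_sub_le (F t) c (F s)
          rw [abs_sub_comm c] at this
          simp only
          linarith
      _ = ∫ t, |F t - c| ∂(gaussianReal 0 1) + 2 * (9 * √δ) := by
          rw [integral_add (hi c hc0 hc1) (integrable_const _)]
          simp
      _ ≤ 27 * √δ := by linarith
  refine ⟨s, h1, ?_⟩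
  refine (integral_midpoint_gaussianReal_le (u := fun t => |F t - F s|) hs (hm _)
    (fun _ => abs_nonneg _) (hb _ (hF0 s) (hF1 s))).trans ?_
  linarith

/-! ### Slices in the direction `v`. -/

/-- Joint linearity in height and point: with convexity of `K`, it puts combinations of two slices
inside the slice at the combined height. -/
lemma replaceComponent_combo (v : EuclideanSpace ℝ (Fin n)) (l m s t : ℝ)
    (x y : EuclideanSpace ℝ (Fin n)) :
    replaceComponent v (l * s + m * t) (l • x + m • y) =
      l • replaceComponent v s x + m • replaceComponent v t y := by
  simp only [replaceComponent, inner_add_right, inner_smul_right]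
  module

lemma replaceComponent_replaceComponent {v : EuclideanSpace ℝ (Fin n)} (hv : ‖v‖ = 1) (s t : ℝ)
    (x : EuclideanSpace ℝ (Fin n)) :
    replaceComponent v s (replaceComponent v t x) = replaceComponent v s x := by
  have h : ⟪v, v⟫ = (1 : ℝ) := by rw [real_inner_self_eq_norm_sq, hv, one_pow]
  simp only [replaceComponent, inner_add_right, inner_sub_right, inner_smul_right, h]
  module

lemma inner_replaceComponent {v : EuclideanSpace ℝ (Fin n)} (hv : ‖v‖ = 1) (t : ℝ)
    (x : EuclideanSpace ℝ (Fin n)) : ⟪v, replaceComponent v t x⟫ = t := by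
  have h : ⟪v, v⟫ = (1 : ℝ) := by rw [real_inner_self_eq_norm_sq, hv, one_pow]
  simp only [replaceComponent, inner_add_right, inner_sub_right, inner_smul_right, h]
  ring

section Slices

variable (v : EuclideanSpace ℝ (Fin n)) (K : Set (EuclideanSpace ℝ (Fin n)))

/-- The Gaussian measure of the slice of `K` at height `t` in the direction `v`. -/
noncomputable def sliceMeasure (t : ℝ) : ℝ :=
  (stdGaussian (EuclideanSpace ℝ (Fin n))).real (replaceComponent v t ⁻¹' K)

lemma sliceMeasure_nonneg (t : ℝ) : 0 ≤ sliceMeasure v K t := measureReal_nonneg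

lemma sliceMeasure_le_one (t : ℝ) : sliceMeasure v K t ≤ 1 := measureReal_le_one

variable {K}

lemma measurableSet_preimage_replaceComponent (hK : MeasurableSet K) (t : ℝ) :
    MeasurableSet (replaceComponent v t ⁻¹' K) :=
  hK.preimage ((continuous_replaceComponent v).comp (by fun_prop :
    Continuous fun x : EuclideanSpace ℝ (Fin n) => (x, t))).measurable

lemma measurable_sliceMeasure (hK : MeasurableSet K) : Measurable (sliceMeasure v K) := by
  have := measurable_measure_prodMk_right (μ := stdGaussian (EuclideanSpace ℝ (Fin n)))
    (hK.preimage (continuous_replaceComponent v).measurable)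
  exact this.ennreal_toReal

/-- Log-concavity gives `F y ≥ F x ^ l * F z ^ m`, and a weighted geometric mean is at least the
minimum. -/
lemma sliceMeasure_quasiconcave (hK : MeasurableSet K) (hKc : Convex ℝ K) (x y z : ℝ)
    (hxy : x ≤ y) (hyz : y ≤ z) :
    min (sliceMeasure v K x) (sliceMeasure v K z) ≤ sliceMeasure v K y := by
  rcases hxy.eq_or_lt with rfl | hxy
  · exact min_le_left _ _
  rcases hyz.eq_or_lt with rfl | hyz
  · exact min_le_right _ _
  have hzx : 0 < z - x := by linarith
  set l := (z - y) / (z - x) with hl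
  set m := (y - x) / (z - x) with hm
  have hl0 : 0 < l := div_pos (by linarith) hzx
  have hm0 : 0 < m := div_pos (by linarith) hzx
  have hlm : l + m = 1 := by
    rw [hl, hm, ← add_div]
    exact (div_eq_one_iff_eq hzx.ne').2 (by ring)
  have hy : y = l * x + m * z := by
    rw [hl, hm]
    field_simp
    ring
  have key := stdGaussian_real_rpow_mul_le hl0 hm0 hlm
    (measurableSet_preimage_replaceComponent v hK x)
    (measurableSet_preimage_replaceComponent v hK z)
    (measurableSet_preimage_replaceComponent v hK y) (fun a ha b hb => by
      rw [Set.mem_preimage, hy, replaceComponent_combo]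
      exact hKc ha hb hl0.le hm0.le hlm)
  refine le_trans ?_ key
  have h0 : 0 ≤ min (sliceMeasure v K x) (sliceMeasure v K z) :=
    le_min (sliceMeasure_nonneg _ _ _) (sliceMeasure_nonneg _ _ _)
  calc min (sliceMeasure v K x) (sliceMeasure v K z)
      = min (sliceMeasure v K x) (sliceMeasure v K z) ^ l *
          min (sliceMeasure v K x) (sliceMeasure v K z) ^ m := by
        rw [← Real.rpow_add_of_nonneg h0 hl0.le hm0.le, hlm, Real.rpow_one]
    _ ≤ _ := mul_le_mul (Real.rpow_le_rpow h0 (min_le_left _ _) hl0.le)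
        (Real.rpow_le_rpow h0 (min_le_right _ _) hm0.le) (Real.rpow_nonneg h0 _)
        (Real.rpow_nonneg (sliceMeasure_nonneg _ _ _) _)

end Slices

/-! ### From nearly constant slice measures to nearly equal slices. -/

/-- Once the measures of the sets are close, only the one-sided difference `A \ B` has to be
controlled. -/
lemma integral_abs_indicator_sub {α : Type*} [MeasurableSpace α] {μ : Measure α}
    [IsFiniteMeasure μ] {A B : Set α} (hA : MeasurableSet A) (hB : MeasurableSet B) :
    ∫ x, |A.indicator (1 : α → ℝ) x - B.indicator 1 x| ∂μ =
      2 * μ.real (A \ B) + (μ.real B - μ.real A) := by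
  have e : ∀ x, |A.indicator (1 : α → ℝ) x - B.indicator 1 x| =
      2 * (A \ B).indicator 1 x + (B.indicator 1 x - A.indicator 1 x) := by
    intro x
    by_cases ha : x ∈ A <;> by_cases hb : x ∈ B <;> simp [ha, hb]
    norm_num
  have i : ∀ {S : Set α}, MeasurableSet S → Integrable (S.indicator (1 : α → ℝ)) μ :=
    fun hS => (integrable_const (1 : ℝ)).indicator hS
  simp_rw [e]
  rw [integral_add ((i (hA.diff hB)).const_mul 2) (by exact (i hB).sub (i hA)), integral_const_mul,
    integral_sub (i hB) (i hA), integral_indicator_one hA, integral_indicator_one hB,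
    integral_indicator_one (hA.diff hB)]

/-- Slices of an intersection of `k` halfspaces whose measures are close to equality in the
log-concavity inequality are close to each other. -/
lemma integral_abs_slice_sub_le {k : ℕ} {H : Fin k → Set (EuclideanSpace ℝ (Fin n))}
    (hH : ∀ i, IsHalfspace (H i)) (v : EuclideanSpace ℝ (Fin n)) {ε : ℝ} (hε : 0 < ε) {s : ℝ}
    (hs : 0 < sliceMeasure v (⋂ i, H i) s) (t : ℝ) :
    ∫ x, |(replaceComponent v t ⁻¹' ⋂ i, H i).indicator (1 : EuclideanSpace ℝ (Fin n) → ℝ) x -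
        (replaceComponent v s ⁻¹' ⋂ i, H i).indicator 1 x|
        ∂(stdGaussian (EuclideanSpace ℝ (Fin n))) ≤
      2 * (k * ε) + 8 / ε ^ 2 * (2 * |sliceMeasure v (⋂ i, H i) ((t + s) / 2) -
        sliceMeasure v (⋂ i, H i) s| / sliceMeasure v (⋂ i, H i) s +
        |sliceMeasure v (⋂ i, H i) t - sliceMeasure v (⋂ i, H i) s|) +
        |sliceMeasure v (⋂ i, H i) t - sliceMeasure v (⋂ i, H i) s| := by
  set K := ⋂ i, H i with hK
  have hKm : MeasurableSet K := MeasurableSet.iInter fun i => (hH i).measurableSet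
  have hKc : Convex ℝ K := convex_iInter fun i => (hH i).convex
  have hA := measurableSet_preimage_replaceComponent v hKm t
  have hB := measurableSet_preimage_replaceComponent v hKm s
  have hC := measurableSet_preimage_replaceComponent v hKm ((t + s) / 2)
  rw [integral_abs_indicator_sub hA hB]
  have key := stdGaussian_midpoint_le hε hA hB hC (fun x hx y hy => by
    have e : (t + s) / 2 = 1 / 2 * t + 1 / 2 * s := by ring
    rw [Set.mem_preimage, e, replaceComponent_combo]
    exact hKc hx hy (by norm_num) (by norm_num) (by norm_num))
  have strip := measureReal_thickening_iInter_diff_le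
    (fun i => (hH i).preimage_replaceComponent v s) hε
  rw [← Set.preimage_iInter, ← hK] at strip
  set A := replaceComponent v t ⁻¹' K with hAdef
  set B := replaceComponent v s ⁻¹' K with hBdef
  set γ := stdGaussian (EuclideanSpace ℝ (Fin n)) with hγ
  have eA : γ.real A = sliceMeasure v K t := rfl
  have eB : γ.real B = sliceMeasure v K s := rfl
  have eC : γ.real (replaceComponent v ((t + s) / 2) ⁻¹' K) =
    sliceMeasure v K ((t + s) / 2) := rfl
  rw [eA, eB, eC] at key
  rw [eA, eB]
  have hsub : γ.real (A \ B) ≤ γ.real (A \ Metric.thickening ε B) + k * ε := by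
    calc γ.real (A \ B)
        ≤ γ.real ((A \ Metric.thickening ε B) ∪ (Metric.thickening ε B \ B)) := by
          refine measureReal_mono ?_
          rintro x ⟨hx1, hx2⟩
          by_cases hx : x ∈ Metric.thickening ε B
          · exact Or.inr ⟨hx, hx2⟩
          · exact Or.inl ⟨hx1, hx⟩
      _ ≤ _ := (measureReal_union_le _ _).trans (add_le_add_right strip _)
  have hb1 := sliceMeasure_le_one v K s
  have hc1 := sliceMeasure_le_one v K ((t + s) / 2)
  have hc0 := sliceMeasure_nonneg v K ((t + s) / 2)
  set a := sliceMeasure v K t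
  set b := sliceMeasure v K s
  set c := sliceMeasure v K ((t + s) / 2)
  set d := γ.real (A \ Metric.thickening ε B)
  -- If `a` and `c` are close to `b`, then `c² / b` is close to `a`, so `d`, the part of `A` at
  -- distance at least `ε` from `B`, is small.
  have h1 : a + ε ^ 2 / 4 * d ≤ c ^ 2 / b := by
    rw [le_div_iff₀ hs, mul_comm]
    exact key
  have h2 : c ^ 2 / b ≤ b + 2 * |c - b| / b := by
    rw [div_le_iff₀ hs, add_mul, div_mul_cancel₀ _ hs.ne']
    have e : c ^ 2 - b * b = (c + b) * (c - b) := by ring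
    have h1 : (c + b) * (c - b) ≤ (c + b) * |c - b| :=
      mul_le_mul_of_nonneg_left (le_abs_self _) (by linarith)
    have h2 : (c + b) * |c - b| ≤ 2 * |c - b| :=
      mul_le_mul_of_nonneg_right (by linarith) (abs_nonneg _)
    linarith
  have h3 : b - a ≤ |a - b| := by rw [abs_sub_comm]; exact le_abs_self _
  have h4 : d ≤ 4 / ε ^ 2 * (2 * |c - b| / b + |a - b|) := by
    rw [div_mul_eq_mul_div, le_div_iff₀ (by positivity)]
    linarith
  have h5 : 8 / ε ^ 2 * (2 * |c - b| / b + |a - b|) =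
      2 * (4 / ε ^ 2 * (2 * |c - b| / b + |a - b|)) := by ring
  rw [h5]
  linarith

/-- The crude bound for a reference slice of small measure, where dividing by that measure would be
too costly. -/
lemma integral_abs_slice_sub_le_two_mul {K : Set (EuclideanSpace ℝ (Fin n))} (hK : MeasurableSet K)
    (v : EuclideanSpace ℝ (Fin n)) (s t : ℝ) :
    ∫ x, |(replaceComponent v t ⁻¹' K).indicator (1 : EuclideanSpace ℝ (Fin n) → ℝ) x -
        (replaceComponent v s ⁻¹' K).indicator 1 x|
        ∂(stdGaussian (EuclideanSpace ℝ (Fin n))) ≤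
      2 * sliceMeasure v K s + |sliceMeasure v K t - sliceMeasure v K s| := by
  rw [integral_abs_indicator_sub (measurableSet_preimage_replaceComponent v hK t)
    (measurableSet_preimage_replaceComponent v hK s)]
  have : (stdGaussian (EuclideanSpace ℝ (Fin n))).real
      (replaceComponent v t ⁻¹' K \ replaceComponent v s ⁻¹' K) ≤ sliceMeasure v K t :=
    measureReal_mono Set.sdiff_subset
  have h := le_abs_self (sliceMeasure v K t - sliceMeasure v K s)
  simp only [sliceMeasure] at *
  linarith

/-- The slices of an intersection of `k` halfspaces are close on average to the slice at height `s`
if their Gaussian measures are close to a constant. -/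
lemma integral_integral_abs_slice_sub_le {k : ℕ} (hk : 1 ≤ k)
    {H : Fin k → Set (EuclideanSpace ℝ (Fin n))}
    (hH : ∀ i, IsHalfspace (H i)) (v : EuclideanSpace ℝ (Fin n)) {s q w : ℝ} (hw : 0 < w)
    (hqw : w ^ 4 = q * k ^ 2)
    (h1 : ∫ t, |sliceMeasure v (⋂ i, H i) t - sliceMeasure v (⋂ i, H i) s| ∂(gaussianReal 0 1) ≤ q)
    (h2 : ∫ t, |sliceMeasure v (⋂ i, H i) ((t + s) / 2) - sliceMeasure v (⋂ i, H i) s|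
      ∂(gaussianReal 0 1) ≤ 6 * q) :
    ∫ t, ∫ x, |(replaceComponent v t ⁻¹' ⋂ i, H i).indicator
          (1 : EuclideanSpace ℝ (Fin n) → ℝ) x -
        (replaceComponent v s ⁻¹' ⋂ i, H i).indicator 1 x|
        ∂(stdGaussian (EuclideanSpace ℝ (Fin n))) ∂(gaussianReal 0 1) ≤ 106 * w + q := by
  have hk0 : (1 : ℝ) ≤ k := by exact_mod_cast hk
  set K := ⋂ i, H i with hK
  have hKm : MeasurableSet K := MeasurableSet.iInter fun i => (hH i).measurableSet
  set F := sliceMeasure v K with hF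
  have hFm : Measurable F := measurable_sliceMeasure v hKm
  have F0 : ∀ t, 0 ≤ F t := sliceMeasure_nonneg v K
  have F1 : ∀ t, F t ≤ 1 := sliceMeasure_le_one v K
  have hbd : ∀ t, |F t - F s| ≤ 1 := fun t => abs_le.2 ⟨by linarith [F0 t, F1 s], by
    linarith [F1 t, F0 s]⟩
  have i1 : Integrable (fun t => |F t - F s|) (gaussianReal 0 1) :=
    integrable_of_nonneg_of_le (hFm.sub_const _).abs (fun _ => abs_nonneg _) hbd
  have i2 : Integrable (fun t => |F ((t + s) / 2) - F s|) (gaussianReal 0 1) :=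
    integrable_of_nonneg_of_le (((hFm.comp (by fun_prop : Measurable fun t : ℝ =>
      (t + s) / 2)).sub_const _).abs) (fun _ => abs_nonneg _) fun _ => hbd _
  have nn : ∀ t, 0 ≤ ∫ x, |(replaceComponent v t ⁻¹' K).indicator
      (1 : EuclideanSpace ℝ (Fin n) → ℝ) x - (replaceComponent v s ⁻¹' K).indicator 1 x|
      ∂(stdGaussian (EuclideanSpace ℝ (Fin n))) := fun t => integral_nonneg fun _ => abs_nonneg _
  rcases le_or_gt (F s) w with hb | hb
  · calc _ ≤ ∫ t, (2 * F s + |F t - F s|) ∂(gaussianReal 0 1) :=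
          integral_mono_of_nonneg (Filter.Eventually.of_forall nn)
            ((integrable_const _).add i1)
            (Filter.Eventually.of_forall fun t => integral_abs_slice_sub_le_two_mul hKm v s t)
      _ = 2 * F s + ∫ t, |F t - F s| ∂(gaussianReal 0 1) := by
          rw [integral_add (integrable_const _) i1]
          simp
      _ ≤ _ := by linarith
  · have hs : 0 < F s := hw.trans hb
    -- This choice balances the boundary term `2kε = 2w` against the log-concavity term `8/ε² *
    -- 13q/w = 104w`, using `q = w² ε²`. The `13` is `2 * 6 + 1`, with `q ≤ q/w` because `w < F s ≤
    -- 1`.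
    set ε := w / k with hεdef
    have hε : 0 < ε := div_pos hw (by linarith)
    have hkε : k * ε = w := by rw [hεdef]; field_simp
    have hq : q = w ^ 2 * ε ^ 2 := by
      rw [hεdef]
      field_simp
      linarith
    have hq0 : 0 < q := by rw [hq]; positivity
    have j2 := (i2.const_mul 2).div_const (F s)
    have j3 := (j2.add i1).const_mul (8 / ε ^ 2)
    have j4 := (integrable_const (μ := gaussianReal 0 1) (2 * (k * ε))).add j3
    calc _ ≤ ∫ t, (2 * (k * ε) + 8 / ε ^ 2 * (2 * |F ((t + s) / 2) - F s| / F s +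
          |F t - F s|) + |F t - F s|) ∂(gaussianReal 0 1) :=
          integral_mono_of_nonneg (Filter.Eventually.of_forall nn)
            (j4.add i1) (Filter.Eventually.of_forall fun t => integral_abs_slice_sub_le hH v hε hs t)
      _ = 2 * (k * ε) + 8 / ε ^ 2 * (2 * (∫ t, |F ((t + s) / 2) - F s| ∂(gaussianReal 0 1)) / F s +
          ∫ t, |F t - F s| ∂(gaussianReal 0 1)) + ∫ t, |F t - F s| ∂(gaussianReal 0 1) := by
          rw [integral_add (by exact j4) i1, integral_add (integrable_const _) (by exact j3),
            integral_const_mul (8 / ε ^ 2), integral_add (by exact j2) i1, integral_div,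
            integral_const_mul 2 fun t => |F ((t + s) / 2) - F s|]
          simp
      _ ≤ 2 * (k * ε) + 8 / ε ^ 2 * (13 * q / w) + q := by
          refine add_le_add (add_le_add_right (mul_le_mul_of_nonneg_left ?_ (by positivity)) _) h1
          have hw1 : w ≤ 1 := hb.le.trans (F1 s)
          calc _ ≤ 2 * (6 * q) / w + q / w := by
                refine add_le_add (div_le_div₀ (by positivity) (by linarith) hw hb.le) ?_
                exact h1.trans ((le_div_iff₀ hw).2 (by nlinarith))
            _ = 13 * q / w := by ring
      _ = 106 * w + q := by
          rw [hkε, hq]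
          field_simp
          ring

/-! ### Transfer between the resampled pair and the slices. -/

/-- The standard Gaussian measure is unchanged if the component in a direction is resampled. -/
lemma IsResampledAlong.map_replaceComponent {Ω : Type*} [MeasurableSpace Ω] {P : Measure Ω}
    {v : EuclideanSpace ℝ (Fin n)} (hv : ‖v‖ = 1) {G G' : Ω → EuclideanSpace ℝ (Fin n)}
    (h : IsResampledAlong P v G G') :
    ((stdGaussian (EuclideanSpace ℝ (Fin n))).prod (gaussianReal 0 1)).map
      (fun p => replaceComponent v p.2 p.1) = stdGaussian (EuclideanSpace ℝ (Fin n)) := by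
  have hG := h.law_left
  have hG' := h.law_right
  have : IsProbabilityMeasure P := hG.isProbabilityMeasure
  have hτm : AEMeasurable (fun ω => ⟪v, G' ω⟫) P :=
    (by fun_prop : Measurable fun x : EuclideanSpace ℝ (Fin n) => ⟪v, x⟫).comp_aemeasurable
      hG'.aemeasurable
  have hτ : P.map (fun ω => ⟪v, G' ω⟫) = gaussianReal 0 1 := by
    rw [← stdGaussian_map_inner hv, ← hG'.map_eq,
      AEMeasurable.map_map_of_aemeasurable (by fun_prop) hG'.aemeasurable]
    rfl
  -- Almost surely `G'` is `G` with its `v`-component replaced by `⟪v, G'⟫`, and by independence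
  -- this pair has the product law.
  have hprod := (indepFun_iff_map_prod_eq_prod_map_map hG.aemeasurable hτm).1
    h.indep_direction.symm
  rw [hG.map_eq, hτ] at hprod
  rw [← hprod, AEMeasurable.map_map_of_aemeasurable
    (continuous_replaceComponent v).measurable.aemeasurable (hG.aemeasurable.prodMk hτm),
    ← hG'.map_eq]
  refine Measure.map_congr ?_
  filter_upwards [h.same_orthogonal] with ω hω
  simp only [Function.comp, replaceComponent]
  rw [← hω]
  abel

lemma indicator_replaceComponent (K : Set (EuclideanSpace ℝ (Fin n)))
    (v x : EuclideanSpace ℝ (Fin n)) (t : ℝ) :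
    K.indicator (fun _ => (1 : ℝ)) (replaceComponent v t x) =
      (replaceComponent v t ⁻¹' K).indicator 1 x := rfl

/-- Fubini in the resampled component turns the correlation hypothesis on `f` into one on the
one-variable function `sliceMeasure v K`. -/
lemma integral_indicator_mul_inner {v : EuclideanSpace ℝ (Fin n)} (hv : ‖v‖ = 1)
    {K : Set (EuclideanSpace ℝ (Fin n))} (hK : MeasurableSet K)
    (hmap : ((stdGaussian (EuclideanSpace ℝ (Fin n))).prod (gaussianReal 0 1)).map
      (fun p => replaceComponent v p.2 p.1) = stdGaussian (EuclideanSpace ℝ (Fin n)))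
    (p : Polynomial ℝ) :
    ∫ x, K.indicator (fun _ => (1 : ℝ)) x * p.eval ⟪v, x⟫
        ∂(stdGaussian (EuclideanSpace ℝ (Fin n))) =
      ∫ t, sliceMeasure v K t * p.eval t ∂(gaussianReal 0 1) := by
  have hc := (continuous_replaceComponent v).measurable
  have hp : Measurable fun t => p.eval t := p.continuous.measurable
  have hKi : Measurable (K.indicator (fun _ => (1 : ℝ))) := measurable_const.indicator hK
  have hm : Measurable fun x => K.indicator (fun _ => (1 : ℝ)) x * p.eval ⟪v, x⟫ :=
    hKi.mul (hp.comp (by fun_prop))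
  nth_rw 1 [← hmap]
  rw [integral_map hc.aemeasurable hm.aestronglyMeasurable]
  simp_rw [inner_replaceComponent hv]
  rw [integral_prod_symm]
  · simp_rw [indicator_replaceComponent, integral_mul_const]
    congr 1
    ext t
    rw [integral_indicator_one (measurableSet_preimage_replaceComponent v hK t)]
    rfl
  · have : Integrable (fun z : EuclideanSpace ℝ (Fin n) × ℝ => p.eval z.2)
        ((stdGaussian (EuclideanSpace ℝ (Fin n))).prod (gaussianReal 0 1)) :=
      (integrable_polynomial_gaussianReal p).comp_snd _
    refine this.bdd_mul (c := 1) (hKi.comp hc).aestronglyMeasurable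
      (Filter.Eventually.of_forall fun z => ?_)
    rw [Real.norm_of_nonneg (Set.indicator_nonneg (fun _ _ => zero_le_one) _)]
    exact Set.indicator_le_self' (fun _ _ => zero_le_one) _

/-- Triangle inequality through the cylinder over the slice at height `s`: its indicator ignores the
`v`-component, hence agrees at `G` and `G'`. The two resulting terms have equal means, which gives
the factor `2`. -/
lemma IsResampledAlong.integral_abs_sub_le {Ω : Type*} [MeasurableSpace Ω] {P : Measure Ω}
    {v : EuclideanSpace ℝ (Fin n)} (hv : ‖v‖ = 1) {G G' : Ω → EuclideanSpace ℝ (Fin n)}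
    (h : IsResampledAlong P v G G') {K : Set (EuclideanSpace ℝ (Fin n))} (hK : MeasurableSet K)
    (s : ℝ) :
    ∫ ω, |K.indicator (fun _ => (1 : ℝ)) (G ω) - K.indicator (fun _ => (1 : ℝ)) (G' ω)| ∂P ≤
      2 * ∫ t, ∫ x, |(replaceComponent v t ⁻¹' K).indicator
          (1 : EuclideanSpace ℝ (Fin n) → ℝ) x - (replaceComponent v s ⁻¹' K).indicator 1 x|
        ∂(stdGaussian (EuclideanSpace ℝ (Fin n))) ∂(gaussianReal 0 1) := by
  have hG := h.law_left
  have hG' := h.law_right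
  have : IsProbabilityMeasure P := hG.isProbabilityMeasure
  have hc := (continuous_replaceComponent v).measurable
  have hKi : Measurable (K.indicator (fun _ => (1 : ℝ))) := measurable_const.indicator hK
  have hBi : Measurable ((replaceComponent v s ⁻¹' K).indicator
      (1 : EuclideanSpace ℝ (Fin n) → ℝ)) :=
    measurable_one.indicator (measurableSet_preimage_replaceComponent v hK s)
  set g : EuclideanSpace ℝ (Fin n) → ℝ := fun x =>
    |K.indicator (fun _ => (1 : ℝ)) x - (replaceComponent v s ⁻¹' K).indicator 1 x| with hg
  have hgm : Measurable g := (hKi.sub hBi).abs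
  have hg0 : ∀ x, 0 ≤ g x := fun _ => abs_nonneg _
  have hg1 : ∀ x, g x ≤ 1 := by
    intro x
    have a0 : 0 ≤ K.indicator (fun _ => (1 : ℝ)) x :=
      Set.indicator_nonneg (fun _ _ => zero_le_one) x
    have a1 : K.indicator (fun _ => (1 : ℝ)) x ≤ 1 :=
      Set.indicator_le_self' (fun _ _ => zero_le_one) x
    have b0 : 0 ≤ (replaceComponent v s ⁻¹' K).indicator
        (1 : EuclideanSpace ℝ (Fin n) → ℝ) x := Set.indicator_nonneg (fun _ _ => zero_le_one) x
    have b1 : (replaceComponent v s ⁻¹' K).indicator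
        (1 : EuclideanSpace ℝ (Fin n) → ℝ) x ≤ 1 :=
      Set.indicator_le_self' (fun _ _ => zero_le_one) x
    exact abs_le.2 ⟨by linarith, by linarith⟩
  have hgi : Integrable g (stdGaussian (EuclideanSpace ℝ (Fin n))) :=
    integrable_of_nonneg_of_le hgm hg0 hg1
  have hval : ∫ x, g x ∂(stdGaussian (EuclideanSpace ℝ (Fin n))) =
      ∫ t, ∫ x, |(replaceComponent v t ⁻¹' K).indicator
          (1 : EuclideanSpace ℝ (Fin n) → ℝ) x - (replaceComponent v s ⁻¹' K).indicator 1 x|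
        ∂(stdGaussian (EuclideanSpace ℝ (Fin n))) ∂(gaussianReal 0 1) := by
    nth_rw 1 [← h.map_replaceComponent hv]
    rw [integral_map hc.aemeasurable hgm.aestronglyMeasurable, integral_prod_symm]
    · refine integral_congr_ae (Filter.Eventually.of_forall fun t => ?_)
      refine integral_congr_ae (Filter.Eventually.of_forall fun x => ?_)
      simp only [hg, indicator_replaceComponent]
      rw [← indicator_replaceComponent K v (replaceComponent v t x),
        replaceComponent_replaceComponent hv, indicator_replaceComponent]
    · exact integrable_of_nonneg_of_le (hgm.comp hc) (fun _ => hg0 _) (fun _ => hg1 _)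
  have jG : Integrable (fun ω => g (G ω)) P :=
    (hG.map_eq ▸ hgi : Integrable g (P.map G)).comp_aemeasurable hG.aemeasurable
  have jG' : Integrable (fun ω => g (G' ω)) P :=
    (hG'.map_eq ▸ hgi : Integrable g (P.map G')).comp_aemeasurable hG'.aemeasurable
  calc ∫ ω, |K.indicator (fun _ => (1 : ℝ)) (G ω) - K.indicator (fun _ => (1 : ℝ)) (G' ω)| ∂P
      ≤ ∫ ω, (g (G ω) + g (G' ω)) ∂P := by
        refine integral_mono_of_nonneg (Filter.Eventually.of_forall fun _ => abs_nonneg _)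
          (jG.add jG') ?_
        filter_upwards [h.same_orthogonal] with ω hω
        have e : (replaceComponent v s ⁻¹' K).indicator
            (1 : EuclideanSpace ℝ (Fin n) → ℝ) (G ω) =
            (replaceComponent v s ⁻¹' K).indicator 1 (G' ω) := by
          rw [← indicator_replaceComponent, ← indicator_replaceComponent]
          simp only [replaceComponent, hω]
        simp only [hg]
        rw [← e, abs_sub_comm (K.indicator _ (G' ω))]
        exact abs_sub_le _ _ _
    _ = 2 * ∫ x, g x ∂(stdGaussian (EuclideanSpace ℝ (Fin n))) := by
        have e1 : ∫ ω, g (G ω) ∂P = ∫ x, g x ∂(stdGaussian (EuclideanSpace ℝ (Fin n))) :=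
          hG.integral_comp hgm.aestronglyMeasurable
        have e2 : ∫ ω, g (G' ω) ∂P = ∫ x, g x ∂(stdGaussian (EuclideanSpace ℝ (Fin n))) :=
          hG'.integral_comp hgm.aestronglyMeasurable
        rw [integral_add jG jG', e1, e2, two_mul]
    _ = _ := by rw [hval]

/-! ### Numerical comparison and conclusion. -/

/-- Comparison of a bound of order `(δ * k ^ 4) ^ (1 / 8)` with the bound of `mainTheorem7`. -/
lemma rpow_bound {k δ w X : ℝ} (hk : 1 ≤ k) (hδ : 0 < δ) (hδk : δ ≤ k / 2)
    (hwq : w ^ 4 = 27 * √δ * k ^ 2) (hX1 : X ≤ 1)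
    (hX : X ≤ 2 * (106 * w + 27 * √δ)) :
    X ≤ 2000 * (δ ^ (1 / 11 : ℝ) * k ^ (4 / 11 : ℝ) * Real.log (k / δ) ^ (2 / 11 : ℝ)) := by
  have hk0 : 0 < k := by linarith
  -- The hypothesis `δ ≤ k / 2` keeps the logarithmic factor at least `1/2`, so it costs only a
  -- factor `2` in the constant.
  have hL : 1 / 2 ≤ Real.log (k / δ) := by
    have h2 : (2 : ℝ) ≤ k / δ := (le_div_iff₀ hδ).2 (by linarith)
    have := Real.log_le_log (by norm_num) h2
    linarith [Real.log_two_gt_d9]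
  have hL' : 1 / 2 ≤ Real.log (k / δ) ^ (2 / 11 : ℝ) := by
    calc (1 / 2 : ℝ) = (1 / 2 : ℝ) ^ (1 : ℝ) := (Real.rpow_one _).symm
      _ ≤ (1 / 2 : ℝ) ^ (2 / 11 : ℝ) :=
          Real.rpow_le_rpow_of_exponent_ge (by norm_num) (by norm_num) (by norm_num)
      _ ≤ _ := Real.rpow_le_rpow (by norm_num) hL (by norm_num)
  set z := δ * k ^ 4 with hz
  have hz0 : 0 < z := by positivity
  have hzr : δ ^ (1 / 11 : ℝ) * k ^ (4 / 11 : ℝ) = z ^ (1 / 11 : ℝ) := by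
    rw [hz, Real.mul_rpow hδ.le (by positivity), ← Real.rpow_natCast_mul hk0.le]
    norm_num
  rw [hzr]
  have hzp : 0 < z ^ (1 / 11 : ℝ) := Real.rpow_pos_of_pos hz0 _
  suffices hfin : X ≤ 1000 * z ^ (1 / 11 : ℝ) by nlinarith
  -- For `z ≥ 1` the bound `X ≤ 1` suffices. For `z < 1`, `w ≤ 3y` and `√δ ≤ y` with `y = z^(1/8) ≤
  -- z^(1/11)`, and `2 * (106 * 3 + 27) = 690` is below `1000`.
  rcases le_or_gt 1 z with h1 | h1
  · have : (1 : ℝ) ≤ z ^ (1 / 11 : ℝ) := Real.one_le_rpow h1 (by norm_num)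
    linarith
  · set y := z ^ (1 / 8 : ℝ) with hy
    have hy0 : 0 < y := Real.rpow_pos_of_pos hz0 _
    have hyz : y ≤ z ^ (1 / 11 : ℝ) :=
      Real.rpow_le_rpow_of_exponent_ge hz0 h1.le (by norm_num)
    have hy1 : y ≤ 1 := Real.rpow_le_one hz0.le h1.le (by norm_num)
    have hy8 : y ^ 8 = z := by
      rw [hy, ← Real.rpow_mul_natCast hz0.le]
      norm_num
    have hy4 : y ^ 4 = √δ * k ^ 2 := by
      have e : (√δ * k ^ 2) ^ 2 = (y ^ 4) ^ 2 := by
        rw [← pow_mul, hy8, mul_pow, Real.sq_sqrt hδ.le, hz]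
        ring
      exact ((pow_left_inj₀ (by positivity) (by positivity) two_ne_zero).1 e).symm
    have hwy : w ≤ 3 * y := by
      refine le_of_pow_le_pow_left₀ four_ne_zero (by positivity) ?_
      rw [hwq, mul_pow, hy4]
      have : 0 ≤ √δ * k ^ 2 := by positivity
      linarith
    have hδy : √δ ≤ y := by
      have h1 : √δ ≤ √δ * k ^ 2 := le_mul_of_one_le_right (Real.sqrt_nonneg _) (one_le_pow₀ hk)
      rw [← hy4] at h1
      refine h1.trans ?_
      calc y ^ 4 ≤ y ^ 1 := pow_le_pow_of_le_one hy0.le hy1 (by norm_num)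
        _ = y := pow_one y
    linarith

theorem mainTheorem7 :
    ∃ C : ℝ, 0 < C ∧
      ∀ (n k : ℕ) (f : EuclideanSpace ℝ (Fin n) → ℝ) (v : EuclideanSpace ℝ (Fin n)) (δ : ℝ),
        IsHalfspaceIntersectionIndicator k f →
        ‖v‖ = 1 →
        0 < δ → δ ≤ (k : ℝ) / 2 →
        (∀ p : Polynomial ℝ, p.natDegree ≤ 2 →
          ∫ t, p.eval t ∂(gaussianReal 0 1) = 0 →
          ∫ t, (p.eval t) ^ 2 ∂(gaussianReal 0 1) = 1 →
          |∫ x, f x * p.eval ⟪v, x⟫ ∂(stdGaussian (EuclideanSpace ℝ (Fin n)))| < δ) →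
        ∀ {Ω : Type*} [MeasurableSpace Ω] (P : Measure Ω)
          (G G' : Ω → EuclideanSpace ℝ (Fin n)),
          IsResampledAlong P v G G' →
          ∫ ω, |f (G ω) - f (G' ω)| ∂P ≤
            C * (δ ^ (1 / 11 : ℝ) * (k : ℝ) ^ (4 / 11 : ℝ) *
              Real.log ((k : ℝ) / δ) ^ (2 / 11 : ℝ)) := by
  refine ⟨2000, by norm_num, ?_⟩
  rintro n k f v δ ⟨H, hH, rfl⟩ hv hδ hδk hp Ω _ P G G' hGG
  have hk : 1 ≤ k := by
    rcases Nat.eq_zero_or_pos k with rfl | h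
    · simp at hδk
      linarith
    · exact h
  have hk1 : (1 : ℝ) ≤ k := by exact_mod_cast hk
  have hKm : MeasurableSet (⋂ i, H i) := MeasurableSet.iInter fun i => (hH i).measurableSet
  have hKc : Convex ℝ (⋂ i, H i) := convex_iInter fun i => (hH i).convex
  have hmap := hGG.map_replaceComponent hv
  obtain ⟨s, h1, h2⟩ := exists_center (F := sliceMeasure v (⋂ i, H i)) hδ
    (measurable_sliceMeasure v hKm) (sliceMeasure_nonneg v _) (sliceMeasure_le_one v _)
    (sliceMeasure_quasiconcave v hKm hKc) (fun p hdeg hp0 hp1 => by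
      rw [← integral_indicator_mul_inner hv hKm hmap]
      exact hp p hdeg hp0 hp1)
  have hq : 0 < 27 * √δ * (k : ℝ) ^ 2 := by
    have := Real.sqrt_pos.2 hδ
    positivity
  set w := (27 * √δ * (k : ℝ) ^ 2) ^ (1 / 4 : ℝ) with hw
  have hw0 : 0 < w := Real.rpow_pos_of_pos hq _
  have hw4 : w ^ 4 = 27 * √δ * (k : ℝ) ^ 2 := by
    rw [hw, ← Real.rpow_mul_natCast hq.le]
    norm_num
  have hX := integral_integral_abs_slice_sub_le hk hH v hw0 hw4 h1 h2
  refine rpow_bound hk1 hδ hδk hw4 ?_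
    ((hGG.integral_abs_sub_le hv hKm s).trans (mul_le_mul_of_nonneg_left hX zero_le_two))
  have : IsProbabilityMeasure P := hGG.law_left.isProbabilityMeasure
  have hbd : ∀ x, 0 ≤ (⋂ i, H i).indicator (fun _ => (1 : ℝ)) x ∧
      (⋂ i, H i).indicator (fun _ => (1 : ℝ)) x ≤ 1 := fun x =>
    ⟨Set.indicator_nonneg (fun _ _ => zero_le_one) x,
      Set.indicator_le_self' (fun _ _ => zero_le_one) x⟩
  calc _ ≤ ∫ _, (1 : ℝ) ∂P := by
        refine integral_mono_of_nonneg (Filter.Eventually.of_forall fun _ => abs_nonneg _)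
          (integrable_const _) (Filter.Eventually.of_forall fun ω => ?_)
        exact abs_le.2 ⟨by linarith [(hbd (G ω)).1, (hbd (G' ω)).2],
          by linarith [(hbd (G ω)).2, (hbd (G' ω)).1]⟩
    _ = 1 := by simp
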